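/- A one-dimensional polygonal curve is given by a non-empty sequence of real numbers, its vertices $p_1,\dots,p_m$, and is viewed as a continuous function $P:[0,1]\to\mathbb{R}$ that passes through $p_1,\dots,p_m$ in this order and interpolates linearly between consecutive vertices. The Fréchet distance of two such curves is $d_F(P,Q)=\min_{f,g}\max_{t\in[0,1]}|P(f(t))-Q(g(t))|$, where $f,g$ range over the monotone surjective functions $[0,1]\to[0,1]$. A $\delta$-straightening of $Q$ is a curve $Q'$ whose vertex sequence is a subsequence $Q(t_1),\dots,Q(t_\ell)$, $t_1<\dots<t_\ell$, of the vertices of $Q$ that contains the first and the last vertex of $Q$, such that - $Q'$ is non-degenerate: no vertex of $Q'$ lies on the line segment between its predecessor and its successor; - $d_F\big(\overline{Q(t_i)Q(t_{i+1})},\,Q[t_i,t_{i+1}]\big)\le\delta$ for all $1\le i<\ell$, where $\overline{ab}$ is the directed segment from $a$ to $b$ and $Q[s,t]$ is the subcurve of $Q$ between the parameters $s$ and $t$; - $Q(t)\in\overline{Q(t_i)Q(t_{i+1})}$ for all $1\le i<\ell$ and all $t\in[t_i,t_{i+1}]$. A $\delta$-visiting order of a curve with vertices $u_1,\dots,u_\ell$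 on a curve with vertices $v_1,\dots,v_m$ is a sequence of indices $i_1\le\dots\le i_\ell$ in $\{1,\dots,m\}$ with $|u_j-v_{i_j}|\le\delta$ for all $j$. **Lemma.** Let $P$ and $Q$ be one-dimensional polygonal curves and $\delta$ a real number with $d_F(Q,P)\le\delta$. Then there exists a $\delta$-straightening $Q'$ of $Q$ such that 1. there exists an $11\delta$-visiting order of $Q'$ on $P$, and 2. $d_F(Q',P)\le\delta$. -/

import Mathlib

open scoped unitInterval

noncomputable section

/-- The reparametrizations of `[0,1]`: monotone and surjective functions from `[0,1]` to `[0,1]`. -/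
def Reparam : Type := {f : I → I // Monotone f ∧ Function.Surjective f}

/-- The (continuous) Fréchet distance of two one-dimensional curves `P, Q : [0,1] → ℝ`. The curves
are continuous, so the inner supremum is that of a bounded function. -/
def frechetDist (P Q : C(I, ℝ)) : ℝ :=
  ⨅ φ : Reparam × Reparam, ⨆ t : I, |P (φ.1.1 t) - Q (φ.2.1 t)|

/-- The directed line segment from `a` to `b`, as a curve. -/
def segmentCurve (a b : ℝ) : C(I, ℝ) where
  toFun s := (1 - (s : ℝ)) * a + s * b

/-- The subcurve `P[a,b]`, reparametrized affinely over `[0,1]`. -/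
def subcurve (P : C(I, ℝ)) (a b : I) : C(I, ℝ) where
  toFun s := P ⟨(1 - (s : ℝ)) * a + s * b,
    (convex_Icc (0 : ℝ) 1) a.2 b.2 (sub_nonneg.2 s.2.2) s.2.1 (sub_add_cancel _ _)⟩

/-- A one-dimensional polygonal curve, given by its sequence of `numEdges + 1 ≥ 1` vertices.
Degenerate vertices and repeated points are allowed. -/
structure PolygonalCurve where
  numEdges : ℕ
  vertex : Fin (numEdges + 1) → ℝ

namespace PolygonalCurve

/-- The polygonal curve as a continuous function on `[0,1]`, with the standard parametrization: the
edge from `vertex i` to `vertex (i+1)` is traversed at constant speed while the parameter runs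
through `[i / numEdges, (i+1) / numEdges]`. During that time `numEdges * t - i` runs through
`[0,1]`; it is clamped to `0` before and to `1` after. -/
def curve (P : PolygonalCurve) : C(I, ℝ) where
  toFun t := P.vertex 0 + ∑ i : Fin P.numEdges,
    (P.vertex i.succ - P.vertex i.castSucc) * max 0 (min 1 ((P.numEdges : ℝ) * t - (i : ℕ)))

/-- The parameter `i / numEdges` in `[0,1]` at which the curve passes through `vertex i`. -/
def param (P : PolygonalCurve) (i : Fin (P.numEdges + 1)) : I :=
  ⟨((i : ℕ) : ℝ) / P.numEdges, by positivity,
    div_le_one_of_le₀ (by exact_mod_cast Nat.le_of_lt_succ i.2) (by positivity)⟩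

/-- No vertex lies on the line segment spanned by its predecessor and its successor. -/
def Nondegenerate (P : PolygonalCurve) : Prop :=
  ∀ i j k : Fin (P.numEdges + 1), (i : ℕ) + 1 = j → (j : ℕ) + 1 = k →
    P.vertex j ∉ segment ℝ (P.vertex i) (P.vertex k)

/-- `P'` is a `δ`-simplification of `P`, formed from the subsequence of the vertices of `P` with
the indices `t 0 < t 1 < ⋯`, which contains the first and the last vertex of `P`. -/
structure IsSimplification (δ : ℝ) (P P' : PolygonalCurve)
    (t : Fin (P'.numEdges + 1) → Fin (P.numEdges + 1)) : Prop where
  strictMono : StrictMono t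
  first : t 0 = 0
  last : t (Fin.last _) = Fin.last _
  vertex_eq : ∀ i, P'.vertex i = P.vertex (t i)
  nondegenerate : P'.Nondegenerate
  locality : ∀ i : Fin P'.numEdges,
    frechetDist (segmentCurve (P'.vertex i.castSucc) (P'.vertex i.succ))
      (subcurve P.curve (P.param (t i.castSucc)) (P.param (t i.succ))) ≤ δ

/-- For every edge of `P'`, the subcurve of `P` between the endpoints of that edge stays within the
edge (as a subset of `ℝ`). -/
def IsEdgeRangePreserving (P P' : PolygonalCurve)
    (t : Fin (P'.numEdges + 1) → Fin (P.numEdges + 1)) : Prop :=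
  ∀ i : Fin P'.numEdges, ∀ s ∈ Set.Icc (P.param (t i.castSucc)) (P.param (t i.succ)),
    P.curve s ∈ segment ℝ (P'.vertex i.castSucc) (P'.vertex i.succ)

/-- `P'` is a `δ`-straightening of `P`: an edge-range-preserving `δ`-simplification. -/
def IsStraightening (δ : ℝ) (P P' : PolygonalCurve) : Prop :=
  ∃ t : Fin (P'.numEdges + 1) → Fin (P.numEdges + 1),
    IsSimplification δ P P' t ∧ IsEdgeRangePreserving P P' t

/-- `κ` is a `δ`-visiting order of `Q` on `P`. -/
def IsVisitingOrder (δ : ℝ) (Q P : PolygonalCurve)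
    (κ : Fin (Q.numEdges + 1) → Fin (P.numEdges + 1)) : Prop :=
  Monotone κ ∧ ∀ j, |Q.vertex j - P.vertex (κ j)| ≤ δ

end PolygonalCurve

end

/-! Fix a matching, that is `q = Q ∘ f` and `p = P ∘ g` with `|q - p| ≤ δ` pointwise. A parameter
interval is a shortcut if, up to a common sign, `q` stays between its end values and neither `q` nor
`p` ever falls by more than `2δ`. Every edge of `Q` gives one (`shortcut_edge`). A single edge can
follow `p` over a shortcut within `δ`: the running maximum of `p` minus `δ` stays below the running
minimum of the remainder plus `δ`, so a monotone motion fits in between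
(`Trackable.exists_fraction`). Let `Q'` be a chain of shortcuts with the fewest edges. Range
preservation, locality and the Fréchet bound hold edge by edge; minimality forces consecutive edges
to alternate strictly in direction, whence non-degeneracy.

For the visiting order, a turn of `Q'` between two edges longer than `2δ` forces an extremum of `p`,
attained at a vertex of `P`, within `δ` of the turn. So does the left end of an inner edge no longer
than its neighbours: merging the three edges is not a shortcut, hence either that edge is longer
than `2δ` or `p` falls too far (`IsPeak.exists_mem_of_not_shortcut`). Such vertices and the two ends
of `Q'` are the anchors. Any other vertex is on an edge of length at most `4δ`; sliding repeatedly
to a neighbouring edge that is not longer passes through nested edges, keeps the order, and stops at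
an anchor (`Alternates.exists_anchor`). This gives a visiting order within `4δ + δ = 5δ`, well below
`11δ`.

The distance is an infimum, so matchings are available only for each `ε > δ`. There are finitely
many candidates for `Q'` and its visiting order, so one serves all `ε > δ`, and the closed
inequalities pass to the limit. -/

/-! ### Fréchet distance and reparametrizations. -/

theorem frechetDist_le {P Q : C(I, ℝ)} {δ : ℝ} (φ ψ : Reparam)
    (h : ∀ t, |P (φ.1 t) - Q (ψ.1 t)| ≤ δ) : frechetDist P Q ≤ δ :=
  (ciInf_le ⟨0, by rintro _ ⟨x, rfl⟩; exact Real.iSup_nonneg fun _ => abs_nonneg _⟩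
    (φ, ψ)).trans (ciSup_le h)

theorem exists_reparam_of_frechetDist_lt {P Q : C(I, ℝ)} {δ : ℝ} (h : frechetDist P Q < δ) :
    ∃ φ ψ : Reparam, ∀ t, |P (φ.1 t) - Q (ψ.1 t)| ≤ δ := by
  have : Nonempty (Reparam × Reparam) :=
    ⟨⟨⟨id, monotone_id, Function.surjective_id⟩, ⟨id, monotone_id, Function.surjective_id⟩⟩⟩
  obtain ⟨⟨φ, ψ⟩, h'⟩ := exists_lt_of_ciInf_lt h
  refine ⟨φ, ψ, fun t => (le_ciSup (f := fun t => |P (φ.1 t) - Q (ψ.1 t)|) ?_ t).trans h'.le⟩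
  refine ⟨‖P‖ + ‖Q‖, ?_⟩
  rintro _ ⟨t, rfl⟩
  exact (abs_sub _ _).trans (add_le_add (P.norm_coe_le_norm _) (Q.norm_coe_le_norm _))

theorem Reparam.continuous (φ : Reparam) : Continuous φ.1 :=
  φ.2.1.continuous_of_surjective φ.2.2

theorem Reparam.map_zero (φ : Reparam) : φ.1 0 = 0 := by
  obtain ⟨x, hx⟩ := φ.2.2 0
  exact le_antisymm ((φ.2.1 x.2.1).trans_eq hx) (φ.1 0).2.1

theorem Reparam.map_one (φ : Reparam) : φ.1 1 = 1 := by
  obtain ⟨x, hx⟩ := φ.2.2 1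
  exact le_antisymm (φ.1 1).2.2 (hx.symm.trans_le (φ.2.1 x.2.2))

theorem exists_reparam {Φ : ℝ → ℝ} (hc : Continuous Φ) (hm : Monotone Φ) (h0 : Φ 0 = 0)
    (h1 : Φ 1 = 1) : ∃ φ : Reparam, ∀ t : I, (φ.1 t : ℝ) = Φ t := by
  refine ⟨⟨fun t => ⟨Φ t, h0 ▸ hm t.2.1, h1 ▸ hm t.2.2⟩, fun s t hst => hm hst, fun y => ?_⟩,
    fun t => rfl⟩
  obtain ⟨x, hx, hxy⟩ := intermediate_value_Icc (zero_le_one' ℝ) hc.continuousOn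
    (show (y : ℝ) ∈ Set.Icc (Φ 0) (Φ 1) by rw [h0, h1]; exact y.2)
  exact ⟨⟨x, hx⟩, Subtype.ext hxy⟩

/-! ### Following a curve by a monotone motion. -/

theorem exists_running_max {c : ℝ → ℝ} (hc : Continuous c) :
    ∃ M : ℝ → ℝ, Continuous M ∧ MonotoneOn M (Set.Icc 0 1) ∧
      (∀ s ∈ Set.Icc (0 : ℝ) 1, c s ≤ M s) ∧
      ∀ s ∈ Set.Icc (0 : ℝ) 1, ∃ u ∈ Set.Icc (0 : ℝ) 1, u ≤ s ∧ M s = c u := by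
  -- Scaling `[0, s]` to `[0, 1]` makes the supremum run over a fixed compact set, so it is
  -- continuous in `s`.
  let f : ℝ → ℝ → ℝ := fun s u => c (s * u)
  have hf : Continuous ↿f := hc.comp (continuous_fst.mul continuous_snd)
  have hcpt : ∀ s, IsCompact (f s '' Set.Icc 0 1) := fun s =>
    isCompact_Icc.image (hc.comp (continuous_const.mul continuous_id))
  have hne : ∀ s, (f s '' Set.Icc 0 1).Nonempty := fun s => ⟨_, 0, by simp, rfl⟩
  have hle : ∀ s ∈ Set.Icc (0 : ℝ) 1, ∀ u ∈ Set.Icc (0 : ℝ) s, c u ≤ sSup (f s '' Set.Icc 0 1) := by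
    intro s hs u hu
    refine le_csSup (hcpt s).bddAbove ⟨u / s, ⟨div_nonneg hu.1 hs.1, div_le_one_of_le₀ hu.2 hs.1⟩, ?_⟩
    rcases hs.1.eq_or_lt with rfl | h
    · simp [f, le_antisymm hu.2 hu.1]
    · simp only [f]; congr 1; field_simp
  have hat : ∀ s ∈ Set.Icc (0 : ℝ) 1, ∃ u ∈ Set.Icc (0 : ℝ) 1, u ≤ s ∧
      sSup (f s '' Set.Icc 0 1) = c u := by
    intro s hs
    obtain ⟨u, hu, e⟩ := (hcpt s).sSup_mem (hne s)
    have hus : s * u ≤ s := mul_le_of_le_one_right hs.1 hu.2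
    exact ⟨s * u, ⟨mul_nonneg hs.1 hu.1, hus.trans hs.2⟩, hus, e.symm⟩
  refine ⟨fun s => sSup (f s '' Set.Icc 0 1), isCompact_Icc.continuous_sSup hf, ?_,
    fun s hs => hle s hs s ⟨hs.1, le_rfl⟩, hat⟩
  intro s hs s' hs' hss
  obtain ⟨u, hu, hus, e⟩ := hat s hs
  simp only
  rw [e]
  exact hle s' hs' u ⟨hu.1, hus.trans hss⟩

theorem exists_running_min {c : ℝ → ℝ} (hc : Continuous c) :
    ∃ m : ℝ → ℝ, Continuous m ∧ MonotoneOn m (Set.Icc 0 1) ∧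
      (∀ s ∈ Set.Icc (0 : ℝ) 1, m s ≤ c s) ∧
      ∀ s ∈ Set.Icc (0 : ℝ) 1, ∃ u ∈ Set.Icc (0 : ℝ) 1, s ≤ u ∧ m s = c u := by
  have hI : ∀ s ∈ Set.Icc (0 : ℝ) 1, 1 - s ∈ Set.Icc (0 : ℝ) 1 := fun s hs =>
    ⟨by linarith [hs.2], by linarith [hs.1]⟩
  obtain ⟨M, h1, h2, h3, h4⟩ := exists_running_max (c := fun s => -c (1 - s)) (by fun_prop)
  refine ⟨fun s => -M (1 - s), by fun_prop, fun s hs s' hs' hss => ?_, fun s hs => ?_, fun s hs => ?_⟩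
  · exact neg_le_neg (h2 (hI _ hs') (hI _ hs) (by linarith))
  · have := h3 _ (hI s hs)
    simp only [sub_sub_cancel] at this
    linarith
  · obtain ⟨u, hu, hus, e⟩ := h4 _ (hI s hs)
    exact ⟨1 - u, hI u hu, by linarith, by simp [e]⟩

/-- The data needed to follow the curve `c` on `[0, 1]` by a monotone motion from `a` up to `b`. -/
structure Trackable (δ : ℝ) (c : ℝ → ℝ) (a b : ℝ) : Prop where
  left : |c 0 - a| ≤ δ
  right : |c 1 - b| ≤ δ
  mem : ∀ s ∈ Set.Icc (0 : ℝ) 1, a - δ ≤ c s ∧ c s ≤ b + δ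
  drop : ∀ s ∈ Set.Icc (0 : ℝ) 1, ∀ s' ∈ Set.Icc (0 : ℝ) 1, s ≤ s' → c s - c s' ≤ 2 * δ

/-- A position is within `δ` of `c s` as soon as it lies between the running maximum minus `δ` and
the running minimum of the future plus `δ`. The drop bound `2δ` says exactly that this corridor is
nonempty, and both its walls are monotone. -/
theorem Trackable.exists_fraction {δ : ℝ} {c : ℝ → ℝ} {a b : ℝ} (hc : Continuous c) (hab : a < b)
    (h : Trackable δ c a b) : ∃ Φ : ℝ → ℝ, Continuous Φ ∧ MonotoneOn Φ (Set.Icc 0 1) ∧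
      Φ 0 = 0 ∧ Φ 1 = 1 ∧ ∀ s ∈ Set.Icc (0 : ℝ) 1, |a + Φ s * (b - a) - c s| ≤ δ := by
  obtain ⟨M, M1, M2, M3, M4⟩ := exists_running_max hc
  obtain ⟨m, m1, m2, m3, m4⟩ := exists_running_min hc
  let lo : ℝ → ℝ := fun s => max a (M s - δ)
  let hi : ℝ → ℝ := fun s => min b (m s + δ)
  have hlo : MonotoneOn lo (Set.Icc 0 1) := fun s hs s' hs' hss =>
    max_le_max le_rfl (sub_le_sub_right (M2 hs hs' hss) _)
  have hhi : MonotoneOn hi (Set.Icc 0 1) := fun s hs s' hs' hss =>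
    min_le_min le_rfl (add_le_add_left (m2 hs hs' hss) _)
  have hle : ∀ s ∈ Set.Icc (0 : ℝ) 1, lo s ≤ hi s := by
    intro s hs
    obtain ⟨u, hu, hus, e⟩ := M4 s hs
    obtain ⟨u', hu', hus', e'⟩ := m4 s hs
    have h1 := h.mem u hu
    have h2 := h.mem u' hu'
    have h3 := h.drop u hu u' hu' (hus.trans hus')
    refine max_le (le_min hab.le ?_) (le_min ?_ ?_) <;> linarith
  have h01 : (0 : ℝ) ∈ Set.Icc (0 : ℝ) 1 := by simp
  have h11 : (1 : ℝ) ∈ Set.Icc (0 : ℝ) 1 := by simp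
  have hlo0 : lo 0 = a := by
    obtain ⟨u, hu, hu0, e⟩ := M4 0 h01
    have h2 := abs_le.1 h.left
    rw [le_antisymm hu0 hu.1] at e
    exact max_eq_left (by linarith)
  have hhi1 : hi 1 = b := by
    obtain ⟨u, hu, hu1, e⟩ := m4 1 h11
    have h2 := abs_le.1 h.right
    rw [le_antisymm hu.2 hu1] at e
    exact min_eq_left (by linarith)
  -- The lower wall starts at `a` and the upper one ends at `b`, so the weight moves from one to the
  -- other; shifting it towards the larger wall keeps the motion monotone.
  let φ : ℝ → ℝ := fun s => (1 - s) * lo s + s * hi s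
  have hba : 0 < b - a := sub_pos.2 hab
  refine ⟨fun s => (φ s - a) / (b - a), ?_, fun s hs s' hs' hss => ?_, ?_, ?_, fun s hs => ?_⟩
  · simp only [φ, lo, hi]
    fun_prop
  · refine div_le_div_of_nonneg_right (sub_le_sub_right ?_ _) hba.le
    simp only [φ]
    have e1 := mul_le_mul_of_nonneg_left (hlo hs hs' hss) (sub_nonneg.2 hs'.2)
    have e2 := mul_le_mul_of_nonneg_left (hhi hs hs' hss) hs'.1
    have e3 := mul_nonneg (sub_nonneg.2 hss) (sub_nonneg.2 (hle s hs))
    linarith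
  · simp [φ, hlo0]
  · simp [φ, hhi1, hba.ne']
  · rw [div_mul_cancel₀ _ hba.ne', add_sub_cancel]
    have e1 := mul_nonneg hs.1 (sub_nonneg.2 (hle s hs))
    have e2 := mul_nonneg (sub_nonneg.2 hs.2) (sub_nonneg.2 (hle s hs))
    have e3 : M s - δ ≤ lo s := le_max_right _ _
    have e4 : hi s ≤ m s + δ := min_le_right _ _
    have e5 := M3 s hs
    have e6 := m3 s hs
    simp only [φ]
    rw [abs_le]
    constructor <;> linarith

theorem exists_clamped_fraction {δ : ℝ} {c : ℝ → ℝ} {a b : ℝ} (hc : Continuous c)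
    (h : (a ≤ b ∧ Trackable δ c a b) ∨ (b ≤ a ∧ Trackable δ (-c) (-a) (-b))) :
    ∃ Φ : ℝ → ℝ, Continuous Φ ∧ Monotone Φ ∧ (∀ s ≤ 0, Φ s = 0) ∧ (∀ s, 1 ≤ s → Φ s = 1) ∧
      ∀ s ∈ Set.Icc (0 : ℝ) 1, |a + Φ s * (b - a) - c s| ≤ δ := by
  have key : ∃ Φ : ℝ → ℝ, Continuous Φ ∧ MonotoneOn Φ (Set.Icc 0 1) ∧
      Φ 0 = 0 ∧ Φ 1 = 1 ∧ ∀ s ∈ Set.Icc (0 : ℝ) 1, |a + Φ s * (b - a) - c s| ≤ δ := by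
    rcases h with ⟨hab, h⟩ | ⟨hab, h⟩
    · rcases hab.eq_or_lt with rfl | hab
      · refine ⟨id, continuous_id, monotone_id.monotoneOn _, rfl, rfl, fun s hs => ?_⟩
        have := h.mem s hs
        rw [sub_self, mul_zero, add_zero, abs_le]
        constructor <;> linarith
      · exact h.exists_fraction hc hab
    · rcases hab.eq_or_lt with rfl | hab
      · refine ⟨id, continuous_id, monotone_id.monotoneOn _, rfl, rfl, fun s hs => ?_⟩
        have := h.mem s hs
        simp only [Pi.neg_apply] at this
        rw [sub_self, mul_zero, add_zero, abs_le]
        constructor <;> linarith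
      · obtain ⟨Φ, h1, h2, h3, h4, h5⟩ := h.exists_fraction hc.neg (neg_lt_neg hab)
        refine ⟨Φ, h1, h2, h3, h4, fun s hs => ?_⟩
        have := h5 s hs
        rw [abs_sub_comm] at this
        convert this using 2
        simp only [Pi.neg_apply]
        ring
  obtain ⟨Φ, h1, h2, h3, h4, h5⟩ := key
  have hcl : ∀ s : ℝ, max 0 (min 1 s) ∈ Set.Icc (0 : ℝ) 1 := fun s =>
    ⟨le_max_left _ _, max_le zero_le_one (min_le_left _ _)⟩
  refine ⟨fun s => Φ (max 0 (min 1 s)), by fun_prop, fun s s' hss => h2 (hcl _) (hcl _)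
    (max_le_max le_rfl (min_le_min le_rfl hss)), fun s hs => ?_, fun s hs => ?_, fun s hs => ?_⟩
  · simp only
    rw [min_eq_right (hs.trans zero_le_one), max_eq_left hs, h3]
  · simp only
    rw [min_eq_left hs, max_eq_right zero_le_one, h4]
  · simp only
    rw [min_eq_right hs.2, max_eq_right hs.1]
    exact h5 s hs

/-! ### Ascents, shortcuts and peaks. -/

/-- On `[x, y]` the function `q` stays between `q x ≤ q y`, and neither `q` nor `p` ever falls by
more than `2 * δ`. -/
structure Ascends {τ : Type*} [LinearOrder τ] (δ : ℝ) (q p : τ → ℝ) (x y : τ) : Prop where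
  mem : ∀ s ∈ Set.Icc x y, q x ≤ q s ∧ q s ≤ q y
  drop_left : ∀ s ∈ Set.Icc x y, ∀ s' ∈ Set.Icc x y, s ≤ s' → q s - q s' ≤ 2 * δ
  drop_right : ∀ s ∈ Set.Icc x y, ∀ s' ∈ Set.Icc x y, s ≤ s' → p s - p s' ≤ 2 * δ

/-- The graph of `q` over `[x, y]` may be replaced by a single edge, up or down. -/
def Shortcut {τ : Type*} [LinearOrder τ] (δ : ℝ) (q p : τ → ℝ) (x y : τ) : Prop :=
  Ascends δ q p x y ∨ Ascends δ (-q) (-p) x y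

/-- `q` ascends on `[x, y]` and descends on `[y, z]`, both strictly in total. -/
structure IsPeak {τ : Type*} [LinearOrder τ] (δ : ℝ) (q p : τ → ℝ) (x y z : τ) : Prop where
  ascends : Ascends δ q p x y
  descends : Ascends δ (-q) (-p) y z
  left_lt : q x < q y
  right_lt : q z < q y

/-- Every strict interior maximum of `p` over an interval is attained at a point of `V`. -/
def HasPeaksIn {τ : Type*} [LinearOrder τ] (p : τ → ℝ) (V : Set τ) : Prop :=
  ∀ x y z, x ≤ y → y ≤ z → p x < p y → p z < p y →
    ∃ θ ∈ V, x < θ ∧ θ < z ∧ ∀ s ∈ Set.Icc x z, p s ≤ p θ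

section Pieces

variable {τ : Type*} [LinearOrder τ] {δ : ℝ} {q p : τ → ℝ} {V : Set τ} {x y z w : τ}

theorem Shortcut.neg (h : Shortcut δ q p x y) : Shortcut δ (-q) (-p) x y := by
  unfold Shortcut at *
  rw [neg_neg, neg_neg]
  exact h.symm

theorem abs_neg_sub_neg_le {α : Type*} {q p : α → ℝ} (h : ∀ t, |q t - p t| ≤ δ) (t : α) : |(-q) t - (-p) t| ≤ δ := by
  have := h t
  rw [abs_sub_comm] at this
  simpa [neg_add_eq_sub] using this

theorem Ascends.of_eq (hqp : ∀ t, |q t - p t| ≤ δ) (h : Ascends δ q p x y) (e : q x = q y) :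
    Ascends δ (-q) (-p) x y := by
  have hc : ∀ s ∈ Set.Icc x y, q s = q x := fun s hs =>
    le_antisymm (e ▸ (h.mem s hs).2) (h.mem s hs).1
  have hδ : 0 ≤ δ := (abs_nonneg _).trans (hqp x)
  refine ⟨fun s hs => ?_, fun s hs s' hs' _ => ?_, fun s hs s' hs' _ => ?_⟩
  · simp [hc s hs, e]
  · simp [hc s hs, hc s' hs', hδ]
  · have h1 := abs_le.1 (hqp s)
    have h2 := abs_le.1 (hqp s')
    have h3 := hc s hs
    have h4 := hc s' hs'
    simp only [Pi.neg_apply]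
    linarith

/-- Across `y` there is no fall of `q`, since `q s ≤ q y ≤ q s'`; hence `p` falls by at most `2δ`
there. -/
theorem Ascends.trans (hqp : ∀ t, |q t - p t| ≤ δ) (hxy : x ≤ y) (hyz : y ≤ z)
    (h₁ : Ascends δ q p x y) (h₂ : Ascends δ q p y z) : Ascends δ q p x z := by
  have hδ : 0 ≤ δ := (abs_nonneg _).trans (hqp x)
  have hx := (h₁.mem x ⟨le_rfl, hxy⟩).2
  have hz := (h₂.mem z ⟨hyz, le_rfl⟩).1
  refine ⟨fun s hs => ?_, fun s hs s' hs' hss => ?_, fun s hs s' hs' hss => ?_⟩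
  · rcases le_total s y with h | h
    · have := h₁.mem s ⟨hs.1, h⟩
      exact ⟨this.1, this.2.trans hz⟩
    · have := h₂.mem s ⟨h, hs.2⟩
      exact ⟨hx.trans this.1, this.2⟩
  · rcases le_total s' y with h' | h'
    · exact h₁.drop_left s ⟨hs.1, hss.trans h'⟩ s' ⟨hs'.1, h'⟩ hss
    rcases le_total s y with h | h
    · have := (h₁.mem s ⟨hs.1, h⟩).2
      have := (h₂.mem s' ⟨h', hs'.2⟩).1
      linarith
    · exact h₂.drop_left s ⟨h, hs.2⟩ s' ⟨h', hs'.2⟩ hss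
  · rcases le_total s' y with h' | h'
    · exact h₁.drop_right s ⟨hs.1, hss.trans h'⟩ s' ⟨hs'.1, h'⟩ hss
    rcases le_total s y with h | h
    · have := (h₁.mem s ⟨hs.1, h⟩).2
      have := (h₂.mem s' ⟨h', hs'.2⟩).1
      have := abs_le.1 (hqp s)
      have := abs_le.1 (hqp s')
      linarith
    · exact h₂.drop_right s ⟨h, hs.2⟩ s' ⟨h', hs'.2⟩ hss

/-- Two ascents would merge, so the second piece descends. A flat piece ascends and descends at once
and would merge too, which makes both inequalities strict. -/
theorem isPeak_of_ascends_of_not_shortcut (hqp : ∀ t, |q t - p t| ≤ δ) (hxy : x ≤ y) (hyz : y ≤ z)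
    (h₁ : Ascends δ q p x y) (h₂ : Shortcut δ q p y z) (h : ¬ Shortcut δ q p x z) :
    IsPeak δ q p x y z := by
  have h₂' : ¬ Ascends δ q p y z := fun h₂ => h (.inl (h₁.trans hqp hxy hyz h₂))
  have h₂'' : Ascends δ (-q) (-p) y z := h₂.resolve_left h₂'
  refine ⟨h₁, h₂'', lt_of_le_of_ne (h₁.mem x ⟨le_rfl, hxy⟩).2 fun e => ?_,
    lt_of_le_of_ne ?_ fun e => ?_⟩
  · exact h (.inr ((h₁.of_eq hqp e).trans (abs_neg_sub_neg_le hqp) hxy hyz h₂''))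
  · simpa using (h₂''.mem z ⟨hyz, le_rfl⟩).1
  · have := h₂''.of_eq (abs_neg_sub_neg_le hqp) (by simp [e])
    rw [neg_neg, neg_neg] at this
    exact h₂' this

theorem isPeak_or_isPeak_neg (hqp : ∀ t, |q t - p t| ≤ δ) (hxy : x ≤ y) (hyz : y ≤ z)
    (h₁ : Shortcut δ q p x y) (h₂ : Shortcut δ q p y z) (h : ¬ Shortcut δ q p x z) :
    IsPeak δ q p x y z ∨ IsPeak δ (-q) (-p) x y z := by
  rcases h₁ with h₁ | h₁
  · exact .inl (isPeak_of_ascends_of_not_shortcut hqp hxy hyz h₁ h₂ h)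
  · refine .inr (isPeak_of_ascends_of_not_shortcut (abs_neg_sub_neg_le hqp) hxy hyz h₁ h₂.neg ?_)
    intro h'
    have := h'.neg
    rw [neg_neg, neg_neg] at this
    exact h this

theorem IsPeak.le_apex (h : IsPeak δ q p x y z) {s : τ} (hs : s ∈ Set.Icc x z) : q s ≤ q y := by
  rcases le_total s y with h' | h'
  · exact (h.ascends.mem s ⟨hs.1, h'⟩).2
  · simpa using (h.descends.mem s ⟨h', hs.2⟩).1

/-- The bounds at `x` and `z` put `p u` strictly above `p x` and `p z`, so the maximum of `p` is
interior and attained in `V`. It is at least `q y - δ` through `u`, and at most `q y + δ` because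
`q` peaks at `y`. -/
theorem IsPeak.exists_mem (hqp : ∀ t, |q t - p t| ≤ δ) (hp : HasPeaksIn p V)
    (h : IsPeak δ q p x y z) {u : τ} (hxu : x ≤ u) (huz : u ≤ z) (hx : q x + δ < p u)
    (hz : q z + δ < p u) (hy : q y - δ ≤ p u) :
    ∃ θ ∈ V, x < θ ∧ θ < z ∧ |p θ - q y| ≤ δ := by
  have h1 := abs_le.1 (hqp x)
  have h2 := abs_le.1 (hqp z)
  obtain ⟨θ, hV, hxθ, hθz, hmax⟩ := hp x u z hxu huz (by linarith) (by linarith)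
  refine ⟨θ, hV, hxθ, hθz, abs_le.2 ?_⟩
  have h3 := hmax u ⟨hxu, huz⟩
  have h4 := h.le_apex ⟨hxθ.le, hθz.le⟩
  have h5 := abs_le.1 (hqp θ)
  constructor <;> linarith

theorem IsPeak.exists_mem_of_long (hqp : ∀ t, |q t - p t| ≤ δ) (hp : HasPeaksIn p V)
    (hxy : x ≤ y) (hyz : y ≤ z) (h : IsPeak δ q p x y z) (hx : 2 * δ < q y - q x)
    (hz : 2 * δ < q y - q z) : ∃ θ ∈ V, x < θ ∧ θ < z ∧ |p θ - q y| ≤ δ := by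
  have h1 := abs_le.1 (hqp y)
  exact h.exists_mem hqp hp hxy hyz (by linarith) (by linarith) (by linarith)

/-- If the edge from `y` to `z` is no longer than its neighbours but cannot be removed, then there
is a point of `V` whose value is close to that at `y`. -/
theorem IsPeak.exists_mem_of_not_shortcut (hqp : ∀ t, |q t - p t| ≤ δ) (hp : HasPeaksIn p V)
    (hxy : x ≤ y) (hyz : y ≤ z) (h : IsPeak δ q p x y z)
    (h' : IsPeak δ (-q) (-p) y z w) (hx : q x ≤ q z) (hw : q y ≤ q w)
    (hn : ¬ Shortcut δ q p x w) : ∃ θ ∈ V, x < θ ∧ θ < z ∧ |p θ - q y| ≤ δ := by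
  by_cases hlong : 2 * δ < q y - q z
  · exact h.exists_mem_of_long hqp hp hxy hyz (by linarith) hlong
  rw [not_lt] at hlong
  have hδ : 0 ≤ δ := (abs_nonneg _).trans (hqp x)
  have hzw' : Ascends δ q p z w := by simpa using h'.descends
  have hle : ∀ s ∈ Set.Icc y w, q z ≤ q s := fun s hs => by simpa using h'.le_apex hs
  have hge : ∀ s ∈ Set.Icc x z, q s ≤ q y := fun s hs => h.le_apex hs
  -- Without such a `θ` the whole of `[x, w]` would be an ascent. Only the bound on the falls of `p`
  -- needs this assumption.
  by_contra hcon
  refine hn (.inl ⟨fun s hs => ⟨?_, ?_⟩, fun s hs s' hs' hss => ?_, fun s hs s' hs' hss => ?_⟩)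
  · rcases le_total s y with h1 | h1
    · exact (h.ascends.mem s ⟨hs.1, h1⟩).1
    · exact hx.trans (hle s ⟨h1, hs.2⟩)
  · rcases le_total s z with h1 | h1
    · exact (hge s ⟨hs.1, h1⟩).trans hw
    · exact (hzw'.mem s ⟨h1, hs.2⟩).2
  · rcases le_total s' y with h1 | h1
    · exact h.ascends.drop_left s ⟨hs.1, hss.trans h1⟩ s' ⟨hs'.1, h1⟩ hss
    rcases le_total s z with h2 | h2
    · have := hge s ⟨hs.1, h2⟩
      have := hle s' ⟨h1, hs'.2⟩
      linarith
    · exact hzw'.drop_left s ⟨h2, hs.2⟩ s' ⟨h2.trans hss, hs'.2⟩ hss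
  · rcases le_total s' y with h1 | h1
    · exact h.ascends.drop_right s ⟨hs.1, hss.trans h1⟩ s' ⟨hs'.1, h1⟩ hss
    rcases le_total s z with h2 | h2
    -- From `q z ≤ q s'` and a fall beyond `2δ` follows `p s > q z + δ`. This exceeds `q x + δ`, and
    -- also `q y - δ` as the middle edge is at most `2δ` long, so `s` is the required high point.
    · by_contra hdrop
      rw [not_le] at hdrop
      have h3 := hle s' ⟨h1, hs'.2⟩
      have h4 := abs_le.1 (hqp s')
      exact hcon (h.exists_mem hqp hp hs.1 h2 (by linarith) (by linarith) (by linarith))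
    · exact hzw'.drop_right s ⟨h2, hs.2⟩ s' ⟨h2.trans hss, hs'.2⟩ hss

end Pieces

/-! ### Shortest chains. -/

/-- A shortest path from `0` to `m` with increasing steps in a relation containing `k ↦ k + 1`. -/
theorem exists_shortest_chain (R : ℕ → ℕ → Prop) (m : ℕ) (hR : ∀ k < m, R k (k + 1)) :
    ∃ (l : ℕ) (t : ℕ → ℕ), t 0 = 0 ∧ t l = m ∧ (∀ i < l, t i < t (i + 1)) ∧
      (∀ i < l, R (t i) (t (i + 1))) ∧ ∀ i j, i + 1 < j → j ≤ l → ¬ R (t i) (t j) := by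
  classical
  have hex : ∃ (l : ℕ), ∃ (t : ℕ → ℕ), t 0 = 0 ∧ t l = m ∧ (∀ i < l, t i < t (i + 1)) ∧
      (∀ i < l, R (t i) (t (i + 1))) := ⟨m, id, rfl, rfl, by simp, by simpa using hR⟩
  obtain ⟨t, h0, hl, hlt, hRt⟩ := Nat.find_spec hex
  refine ⟨Nat.find hex, t, h0, hl, hlt, hRt, fun i j hij hj hRij => ?_⟩
  have hmono : ∀ a b, a < b → b ≤ Nat.find hex → t a < t b := by
    intro a b hab
    induction b, hab using Nat.le_induction with
    | base => intro hb; exact hlt a hb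
    | succ b hab ih => intro hb; exact (ih (by omega)).trans (hlt b hb)
  generalize hN : Nat.find hex = N at *
  have hlt' : N - (j - i - 1) < Nat.find hex := by omega
  -- Cutting out the indices strictly between `i` and `j` leaves a shorter chain.
  refine Nat.find_min hex hlt' ⟨fun k => if k ≤ i then t k else t (k + (j - i - 1)), ?_, ?_, ?_, ?_⟩
  · simp [h0]
  · have h1 : ¬ N - (j - i - 1) ≤ i := by omega
    have h2 : N - (j - i - 1) + (j - i - 1) = N := by omega
    simp [h1, h2, hl]
  · intro k hk
    rcases lt_trichotomy k i with h | h | h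
    · have h1 : k ≤ i := h.le
      have h2 : k + 1 ≤ i := h
      simpa [h1, h2] using hlt k (by omega)
    · subst h
      have h2 : k + 1 + (j - k - 1) = j := by omega
      simpa [h2] using hmono k j (by omega) hj
    · have h1 : ¬ k ≤ i := by omega
      have h2 : ¬ k + 1 ≤ i := by omega
      have h3 : k + 1 + (j - i - 1) = k + (j - i - 1) + 1 := by omega
      simpa only [h1, h2, h3, if_false] using hlt (k + (j - i - 1)) (by omega)
  · intro k hk
    rcases lt_trichotomy k i with h | h | h
    · have h1 : k ≤ i := h.le
      have h2 : k + 1 ≤ i := h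
      simpa [h1, h2] using hRt k (by omega)
    · subst h
      have h2 : k + 1 + (j - k - 1) = j := by omega
      simpa [h2] using hRij
    · have h1 : ¬ k ≤ i := by omega
      have h2 : ¬ k + 1 ≤ i := by omega
      have h3 : k + 1 + (j - i - 1) = k + (j - i - 1) + 1 := by omega
      simpa only [h1, h2, h3, if_false] using hRt (k + (j - i - 1)) (by omega)

/-! ### Sliding to shorter edges. -/

/-- Slide from edge `k` to a neighbouring edge that is not longer, preferring the left one. -/
noncomputable def slide (len : ℕ → ℝ) (l k : ℕ) : ℕ :=
  open Classical in
  if 1 ≤ k ∧ len (k - 1) ≤ len k then k - 1 else if k + 1 < l ∧ len (k + 1) < len k then k + 1 else k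

section Slide

variable {len : ℕ → ℝ} {l : ℕ}

theorem slide_cases (len : ℕ → ℝ) (l k : ℕ) :
    (1 ≤ k ∧ len (k - 1) ≤ len k ∧ slide len l k = k - 1) ∨
    (k + 1 < l ∧ len (k + 1) < len k ∧ slide len l k = k + 1) ∨
    ((1 ≤ k → len k < len (k - 1)) ∧ (k + 1 < l → len k ≤ len (k + 1)) ∧ slide len l k = k) := by
  unfold slide
  split_ifs with h1 h2
  · exact .inl ⟨h1.1, h1.2, rfl⟩
  · exact .inr (.inl ⟨h2.1, h2.2, rfl⟩)
  · push Not at h1 h2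
    exact .inr (.inr ⟨h1, h2, rfl⟩)

/-- Order could be lost only if `k` and `k + 1` were exchanged. The tie rule excludes this: a move
to the right requires a strictly shorter edge, a move to the left one that is not longer. -/
theorem slide_monotone : Monotone (slide len l) := by
  refine monotone_nat_of_le_succ fun k => ?_
  have h1 := slide_cases len l k
  have h2 := slide_cases len l (k + 1)
  simp only [Nat.add_sub_cancel] at h2
  rcases h1 with ⟨_, h1, e1⟩ | ⟨_, h1, e1⟩ | ⟨_, h1, e1⟩ <;>
  rcases h2 with ⟨_, h2, e2⟩ | ⟨_, h2, e2⟩ | ⟨_, h2, e2⟩ <;> rw [e1, e2] <;>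
  first | omega | exact absurd h2 (not_le.2 h1)

theorem slide_lt {k : ℕ} (hk : k < l) : slide len l k < l := by
  rcases slide_cases len l k with ⟨_, _, e⟩ | ⟨_, _, e⟩ | ⟨_, _, e⟩ <;> omega

theorem iterate_slide_lt {k : ℕ} (hk : k < l) (n : ℕ) : (slide len l)^[n] k < l := by
  induction n generalizing k with
  | zero => exact hk
  | succ n ih => exact ih (slide_lt hk)

theorem iterate_fixed_of_rank {f : ℕ → ℕ} {r : ℕ → ℕ} {s : Set ℕ} (hs : ∀ k ∈ s, f k ∈ s)
    (hf : ∀ k ∈ s, f k ≠ k → r (f k) < r k) (n k : ℕ) (hk : k ∈ s) (hr : r k ≤ n) :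
    f (f^[n] k) = f^[n] k := by
  induction n generalizing k with
  | zero =>
    by_contra h
    have := hf k hk h
    omega
  | succ n ih =>
    rw [Function.iterate_succ_apply]
    by_cases h : f k = k
    · rw [h, Function.iterate_fixed h, h]
    · exact ih _ (hs k hk) (by have := hf k hk h; omega)

/-- Each proper move decreases the pair of length and index lexicographically. The number of edges
below in this order is at most `l`, so `l` moves suffice. -/
theorem slide_iterate_fixed {k : ℕ} (hk : k < l) :
    slide len l ((slide len l)^[l] k) = (slide len l)^[l] k := by
  classical
  let S : ℕ → Finset ℕ := fun k =>
    (Finset.range l).filter fun j => len j < len k ∨ (len j = len k ∧ j < k)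
  refine iterate_fixed_of_rank (r := fun k => (S k).card) (s := {k | k < l})
    (fun k hk => slide_lt hk) (fun k hk hne => ?_) l k hk ?_
  · have hlex : len (slide len l k) < len k ∨
        (len (slide len l k) = len k ∧ slide len l k < k) := by
      rcases slide_cases len l k with ⟨h1, h2, e⟩ | ⟨h1, h2, e⟩ | ⟨_, _, e⟩
      · rw [e]
        rcases h2.lt_or_eq with h | h
        · exact .inl h
        · exact .inr ⟨h, by omega⟩
      · rw [e]; exact .inl h2
      · exact absurd e hne
    refine Finset.card_lt_card (Finset.ssubset_iff_of_subset ?_ |>.2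
      ⟨slide len l k, ?_, ?_⟩)
    · intro j hj
      simp only [S, Finset.mem_filter] at hj ⊢
      refine ⟨hj.1, ?_⟩
      rcases hj.2 with h | ⟨h, h'⟩ <;> rcases hlex with g | ⟨g, g'⟩
      · exact .inl (h.trans g)
      · exact .inl (g ▸ h)
      · exact .inl (h ▸ g)
      · exact .inr ⟨h.trans g, h'.trans g'⟩
    · simp only [S, Finset.mem_filter, Finset.mem_range]
      exact ⟨slide_lt hk, hlex⟩
    · simp [S]
  · exact (Finset.card_filter_le _ _).trans (by simp)

end Slide

/-! ### Anchors of a zigzag. -/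

/-- The vertices of a zigzag `v 0, …, v l` that serve as anchors: the ends, the vertices between two
edges longer than `K`, and the left ends of the inner edges that are locally shortest. -/
def IsAnchor (v : ℕ → ℝ) (l : ℕ) (K : ℝ) (j : ℕ) : Prop :=
  j = 0 ∨ j = l ∨
  (0 < j ∧ j < l ∧ K < |v j - v (j - 1)| ∧ K < |v (j + 1) - v j|) ∨
  (0 < j ∧ j + 1 < l ∧ |v (j + 1) - v j| < |v j - v (j - 1)| ∧
    |v (j + 1) - v j| ≤ |v (j + 2) - v (j + 1)|)

/-- Two adjacent anchors cannot both be of the locally shortest kind: the edge between them would be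
at most as long as the next one and also strictly longer. -/
theorem IsAnchor.long_of_succ {v : ℕ → ℝ} {l : ℕ} {K : ℝ} {j : ℕ} (h : IsAnchor v l K j)
    (h' : IsAnchor v l K (j + 1)) (hj : j + 1 ≤ l) :
    j = 0 ∨ j + 1 = l ∨ K < |v (j + 1) - v j| := by
  rcases h with h | h | h | h
  · exact .inl h
  · omega
  · exact .inr (.inr h.2.2.2)
  · rcases h' with h' | h' | h' | h'
    · omega
    · exact .inr (.inl h')
    · exact .inr (.inr h'.2.2.1)
    · exact absurd h.2.2.2 (not_le.2 h'.2.2.1)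

/-- Consecutive edges of `v 0, …, v l` have opposite strict directions. -/
def Alternates (v : ℕ → ℝ) (l : ℕ) : Prop :=
  ∀ i, i + 2 ≤ l → (v i < v (i + 1) ∧ v (i + 2) < v (i + 1)) ∨
    (v (i + 1) < v i ∧ v (i + 1) < v (i + 2))

section Anchors

variable {v : ℕ → ℝ} {l : ℕ} {K : ℝ}

/-- Adjacent edges share an endpoint and turn back there, so the one that is not longer lies inside
the other. -/
theorem Alternates.uIcc_slide_subset (hv : Alternates v l) {k : ℕ} (hk : k < l) :
    Set.uIcc (v (slide (fun i => |v (i + 1) - v i|) l k))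
      (v (slide (fun i => |v (i + 1) - v i|) l k + 1)) ⊆ Set.uIcc (v k) (v (k + 1)) := by
  rcases slide_cases (fun i => |v (i + 1) - v i|) l k with ⟨h1, h2, e⟩ | ⟨h1, h2, e⟩ | ⟨_, _, e⟩
  · obtain ⟨k, rfl⟩ := Nat.exists_eq_add_of_le' h1
    simp only [Nat.add_sub_cancel] at h2 e
    rw [e]
    refine Set.uIcc_subset_uIcc ?_ Set.left_mem_uIcc
    rw [Set.mem_uIcc]
    rcases hv k (by omega) with ⟨a, b⟩ | ⟨a, b⟩
    · rw [abs_of_pos (by linarith), abs_of_neg (by linarith)] at h2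
      exact .inr ⟨by linarith, by linarith⟩
    · rw [abs_of_neg (by linarith), abs_of_pos (by linarith)] at h2
      exact .inl ⟨by linarith, by linarith⟩
  · rw [e]
    refine Set.uIcc_subset_uIcc Set.right_mem_uIcc ?_
    rw [Set.mem_uIcc]
    rcases hv k (by omega) with ⟨a, b⟩ | ⟨a, b⟩
    · rw [abs_of_pos (a := v (k + 1) - v k) (by linarith), abs_of_neg (by linarith)] at h2
      exact .inl ⟨by linarith, by linarith⟩
    · rw [abs_of_neg (a := v (k + 1) - v k) (by linarith), abs_of_pos (by linarith)] at h2
      exact .inr ⟨by linarith, by linarith⟩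
  · rw [e]

theorem Alternates.uIcc_iterate_slide_subset (hv : Alternates v l) {k : ℕ} (hk : k < l) (n : ℕ) :
    Set.uIcc (v ((slide (fun i => |v (i + 1) - v i|) l)^[n] k))
      (v ((slide (fun i => |v (i + 1) - v i|) l)^[n] k + 1)) ⊆ Set.uIcc (v k) (v (k + 1)) := by
  induction n generalizing k with
  | zero => exact subset_rfl
  | succ n ih => exact (ih (slide_lt hk)).trans (hv.uIcc_slide_subset hk)

theorem slide_len_le (len : ℕ → ℝ) (l k : ℕ) : len (slide len l k) ≤ len k := by
  rcases slide_cases len l k with ⟨_, h, e⟩ | ⟨_, h, e⟩ | ⟨_, _, e⟩ <;> rw [e]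
  · exact h
  · exact h.le

/-- Slides never lengthen an edge and move one index at a time, so a short edge can neither land on
nor jump over a long one. -/
theorem lt_iterate_slide {len : ℕ → ℝ} {i k : ℕ} (hi : K < len i) (hk : len k ≤ K) (hik : i < k)
    (n : ℕ) : i < (slide len l)^[n] k := by
  induction n generalizing k with
  | zero => exact hik
  | succ n ih =>
    have h1 := (slide_len_le len l k).trans hk
    refine ih h1 (lt_of_le_of_ne ?_ ?_)
    · rcases slide_cases len l k with ⟨_, _, e⟩ | ⟨_, _, e⟩ | ⟨_, _, e⟩ <;> omega
    · intro h
      rw [← h] at h1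
      exact absurd hi (not_lt.2 h1)

theorem iterate_slide_lt_of_long {len : ℕ → ℝ} {i k : ℕ} (hi : K < len i) (hk : len k ≤ K)
    (hik : k < i) (n : ℕ) : (slide len l)^[n] k < i := by
  induction n generalizing k with
  | zero => exact hik
  | succ n ih =>
    have h1 := (slide_len_le len l k).trans hk
    refine ih h1 (lt_of_le_of_ne ?_ ?_)
    · rcases slide_cases len l k with ⟨_, _, e⟩ | ⟨_, _, e⟩ | ⟨_, _, e⟩ <;> omega
    · intro h
      rw [h] at h1
      exact absurd hi (not_lt.2 h1)

/-- Every short edge slides to an anchor, one of its nested edge's endpoints. -/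
theorem Alternates.exists_edge_anchor (hv : Alternates v l) (K : ℝ) :
    ∃ B : ℕ → ℕ, (∀ k < l, |v (k + 1) - v k| ≤ K → B k ≤ l ∧ IsAnchor v l K (B k) ∧
        ∀ x ∈ Set.uIcc (v k) (v (k + 1)), |v (B k) - x| ≤ K) ∧
      (∀ k k', k ≤ k' → k' < l → B k ≤ B k') ∧
      (∀ i k, 0 < i → i < k → k < l → K < |v (i + 1) - v i| → |v (k + 1) - v k| ≤ K → i < B k) ∧
      (∀ i k, k < i → i < l → K < |v (i + 1) - v i| → |v (k + 1) - v k| ≤ K → B k < i) := by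
  set len : ℕ → ℝ := fun i => |v (i + 1) - v i| with hlen
  -- A fixed edge yields its left end. The last edge, unless it is also the first, yields its right
  -- end `l`, because the locally shortest kind of anchor needs an edge on each side.
  let β : ℕ → ℕ := fun k => if k = 0 then 0 else if k = l - 1 then l else k
  refine ⟨fun k => β ((slide len l)^[l] k), ?_, ?_, ?_, ?_⟩
  · intro k hk hkK
    have hlt := iterate_slide_lt (len := len) hk l
    have hfix := slide_iterate_fixed (len := len) hk
    have hsub := hv.uIcc_iterate_slide_subset hk l
    rw [← hlen] at hsub
    set j := (slide len l)^[l] k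
    have hβ : v (β j) ∈ Set.uIcc (v j) (v (j + 1)) := by
      simp only [β]
      split_ifs with h1 h2
      · rw [h1]; exact Set.left_mem_uIcc
      · rw [show l = j + 1 by omega]; exact Set.right_mem_uIcc
      · exact Set.left_mem_uIcc
    refine ⟨?_, ?_, fun x hx => (Set.abs_sub_le_of_uIcc_subset_uIcc
      (Set.uIcc_subset_uIcc hx (hsub hβ))).trans hkK⟩
    · simp only [β]; split_ifs <;> omega
    · simp only [β]
      split_ifs with h1 h2
      · exact .inl rfl
      · exact .inr (.inl rfl)
      · rcases slide_cases len l j with ⟨_, _, e⟩ | ⟨_, _, e⟩ | ⟨h3, h4, _⟩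
        · omega
        · omega
        · refine .inr (.inr (.inr ⟨by omega, by omega, ?_, ?_⟩))
          · have := h3 (by omega)
            simp only [hlen, show j - 1 + 1 = j by omega] at this
            exact this
          · exact h4 (by omega)
  · intro k k' hkk hk'
    have h1 := (slide_monotone (len := len) (l := l)).iterate l hkk
    have h2 := iterate_slide_lt (len := len) hk' l
    simp only [β]
    split_ifs <;> omega
  · intro i k hi0 hik hk hi hkK
    have h1 := lt_iterate_slide (len := len) (l := l) hi hkK hik l
    have h2 := iterate_slide_lt (len := len) hk l
    simp only [β]
    split_ifs <;> omega
  · intro i k hik hil hi hkK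
    have h1 := iterate_slide_lt_of_long (len := len) (l := l) hi hkK hik l
    simp only [β]
    split_ifs <;> omega

/-- A vertex between two long edges is its own anchor; any other inner vertex follows a short edge
incident to it. Long edges act as barriers to sliding, which keeps the two rules compatible with the
order. -/
theorem Alternates.exists_anchor (hv : Alternates v l) (hK : 0 ≤ K) :
    ∃ A : ℕ → ℕ, (∀ i ≤ l, A i ≤ l ∧ IsAnchor v l K (A i) ∧ |v (A i) - v i| ≤ K) ∧
      ∀ i j, i ≤ j → j ≤ l → A i ≤ A j := by
  classical
  obtain ⟨B, hB, hmono, hright, hleft⟩ := hv.exists_edge_anchor K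
  let e : ℕ → ℕ := fun i => if |v i - v (i - 1)| ≤ K then i - 1 else i
  let long : ℕ → Prop := fun i => K < |v i - v (i - 1)| ∧ K < |v (i + 1) - v i|
  let A : ℕ → ℕ := fun i => if i = 0 then 0 else if i = l then l else if long i then i else B (e i)
  have he : ∀ i, 0 < i → i < l → ¬ long i →
      e i < l ∧ |v (e i + 1) - v (e i)| ≤ K ∧ v i ∈ Set.uIcc (v (e i)) (v (e i + 1)) ∧
        e i ≤ i ∧ i ≤ e i + 1 := by
    intro i h0 hi hlong
    simp only [e]
    split_ifs with h
    · rw [show i - 1 + 1 = i by omega]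
      exact ⟨by omega, h, Set.right_mem_uIcc, by omega, by omega⟩
    · refine ⟨hi, ?_, Set.left_mem_uIcc, by omega, by omega⟩
      by_contra h'
      exact hlong ⟨not_le.1 h, not_le.1 h'⟩
  have hA : ∀ i ≤ l, A i ≤ l ∧ IsAnchor v l K (A i) ∧ |v (A i) - v i| ≤ K := by
    intro i hi
    simp only [A]
    split_ifs with h1 h2 h3
    · exact ⟨by omega, .inl rfl, by simpa [h1] using hK⟩
    · exact ⟨le_rfl, .inr (.inl rfl), by simpa [h2] using hK⟩
    · exact ⟨hi, .inr (.inr (.inl ⟨by omega, by omega, h3.1, h3.2⟩)), by simpa using hK⟩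
    · obtain ⟨g1, g2, g3, -, -⟩ := he i (by omega) (by omega) h3
      obtain ⟨b1, b2, b3⟩ := hB _ g1 g2
      exact ⟨b1, b2, b3 _ g3⟩
  refine ⟨A, hA, fun i j hij hj => ?_⟩
  rcases hij.eq_or_lt with rfl | hij
  · exact le_rfl
  rcases Nat.eq_zero_or_pos i with rfl | hi0
  · simp [A]
  rcases hj.eq_or_lt with rfl | hjl
  · have := (hA i hij.le).1
    simpa [A, show ¬ j = 0 by omega] using this
  have hi := he i hi0 (by omega)
  have hj := he j (by omega) hjl
  have hAi : A i = if long i then i else B (e i) := by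
    simp [A, show ¬ i = 0 by omega, show ¬ i = l by omega]
  have hAj : A j = if long j then j else B (e j) := by
    simp [A, show ¬ j = 0 by omega, show ¬ j = l by omega]
  rw [hAi, hAj]
  split_ifs with h1 h2 h2
  · exact hij.le
  · obtain ⟨g1, g2, g3, g4, g5⟩ := hj h2
    refine (hright i _ hi0 (lt_of_le_of_ne (by omega) fun h => ?_) g1 h1.2 g2).le
    rw [← h] at g2
    exact absurd h1.2 (not_lt.2 g2)
  · obtain ⟨g1, g2, g3, g4, g5⟩ := hi h1
    have h3 : K < |v (j - 1 + 1) - v (j - 1)| := by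
      rw [show j - 1 + 1 = j by omega]
      exact h2.1
    have := hleft (j - 1) (e i) (lt_of_le_of_ne (by omega) fun h => ?_) (by omega) h3 g2
    · omega
    · rw [h] at g2
      exact absurd h3 (not_lt.2 g2)
  · obtain ⟨g1, g2, g3, g4, g5⟩ := hi h1
    obtain ⟨k1, k2, k3, k4, k5⟩ := hj h2
    exact hmono _ _ (by omega) k1

end Anchors

/-! ### Visiting the values at the chain vertices. -/

section Visiting

variable {τ : Type*} [LinearOrder τ] {δ : ℝ} {q p : τ → ℝ} {V : Set τ} {T : ℕ → τ} {l : ℕ}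

theorem alternates_of_minimal (hqp : ∀ t, |q t - p t| ≤ δ) (hT : ∀ i < l, T i < T (i + 1))
    (hS : ∀ i < l, Shortcut δ q p (T i) (T (i + 1)))
    (hmin : ∀ i j, i + 1 < j → j ≤ l → ¬ Shortcut δ q p (T i) (T j)) :
    Alternates (fun i => q (T i)) l := by
  intro i hi
  rcases isPeak_or_isPeak_neg hqp (hT i (by omega)).le (hT (i + 1) (by omega)).le (hS i (by omega))
    (hS (i + 1) (by omega)) (hmin i (i + 2) (by omega) hi) with h | h
  · exact .inl ⟨h.left_lt, h.right_lt⟩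
  · exact .inr ⟨by simpa using h.left_lt, by simpa using h.right_lt⟩

/-- The two kinds of inner anchor match the two sources of extrema: both adjacent edges long, or
three edges that cannot be merged. Valleys reduce to peaks by negation. -/
theorem exists_mem_of_isAnchor (hqp : ∀ t, |q t - p t| ≤ δ) (hp : HasPeaksIn p V)
    (hp' : HasPeaksIn (-p) V) (hT : ∀ i < l, T i < T (i + 1))
    (hS : ∀ i < l, Shortcut δ q p (T i) (T (i + 1)))
    (hmin : ∀ i j, i + 1 < j → j ≤ l → ¬ Shortcut δ q p (T i) (T j)) {j : ℕ} (hj0 : 0 < j)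
    (hjl : j < l) (h : IsAnchor (fun i => q (T i)) l (4 * δ) j) :
    ∃ θ ∈ V, T (j - 1) < θ ∧ θ < T (j + 1) ∧ |p θ - q (T j)| ≤ δ := by
  have key : ∀ q p : τ → ℝ, (∀ t, |q t - p t| ≤ δ) → HasPeaksIn p V →
      (∀ i < l, Shortcut δ q p (T i) (T (i + 1))) →
      (∀ i j, i + 1 < j → j ≤ l → ¬ Shortcut δ q p (T i) (T j)) →
      IsAnchor (fun i => q (T i)) l (4 * δ) j → IsPeak δ q p (T (j - 1)) (T j) (T (j + 1)) →
      ∃ θ ∈ V, T (j - 1) < θ ∧ θ < T (j + 1) ∧ |p θ - q (T j)| ≤ δ := by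
    intro q p hqp hp hS hmin h hpk
    obtain ⟨i, rfl⟩ := Nat.exists_eq_add_of_le' hj0
    simp only [Nat.add_sub_cancel] at hpk h ⊢
    have h1 := hpk.left_lt
    have h2 := hpk.right_lt
    rcases h with h | h | h | h
    · omega
    · omega
    · obtain ⟨-, -, h3, h4⟩ := h
      simp only [Nat.add_sub_cancel] at h3
      rw [abs_of_pos (by linarith)] at h3
      rw [abs_of_neg (by linarith)] at h4
      exact hpk.exists_mem_of_long hqp hp (hT i (by omega)).le (hT _ (by omega)).le (by linarith)
        (by linarith)
    · obtain ⟨-, h5, h3, h4⟩ := h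
      simp only [Nat.add_sub_cancel] at h3
      have hpk' : IsPeak δ (-q) (-p) (T (i + 1)) (T (i + 2)) (T (i + 3)) := by
        refine (isPeak_or_isPeak_neg hqp (hT (i + 1) (by omega)).le (hT (i + 2) (by omega)).le
          (hS _ (by omega)) (hS _ (by omega)) (hmin _ _ (by omega) (by omega))).resolve_left ?_
        intro h
        exact absurd h.left_lt (not_lt.2 h2.le)
      have h6 : q (T (i + 2)) < q (T (i + 3)) := by simpa using hpk'.right_lt
      rw [abs_of_neg (by linarith), abs_of_pos (by linarith)] at h3
      rw [abs_of_neg (by linarith), abs_of_pos (by linarith)] at h4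
      exact hpk.exists_mem_of_not_shortcut hqp hp (hT i (by omega)).le (hT _ (by omega)).le
        hpk' (by linarith) (by linarith) (hmin i (i + 3) (by omega) (by omega))
  have hpeak := isPeak_or_isPeak_neg (x := T (j - 1)) (y := T j) (z := T (j + 1)) hqp
    (by simpa [show j - 1 + 1 = j by omega] using (hT (j - 1) (by omega)).le) (hT j hjl).le
    (by simpa [show j - 1 + 1 = j by omega] using hS (j - 1) (by omega)) (hS j hjl)
    (hmin _ _ (by omega) (by omega))
  rcases hpeak with hpk | hpk
  · exact key q p hqp hp hS hmin h hpk
  · obtain ⟨θ, hV, h1, h2, h3⟩ := key (-q) (-p) (abs_neg_sub_neg_le hqp) hp'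
      (fun i hi => (hS i hi).neg) (fun i j hij hj hs => hmin i j hij hj
        (by simpa only [neg_neg] using hs.neg)) (by
        simpa only [IsAnchor, Pi.neg_apply, neg_sub_neg, abs_sub_comm] using h) hpk
    refine ⟨θ, hV, h1, h2, ?_⟩
    rw [abs_sub_comm]
    simpa [neg_add_eq_sub] using h3

/-- In a chain of shortcuts that cannot be shortened, the values at the vertices are approximated by
those of `p` at points of `V`, in order. -/
theorem exists_monotone_visits (hqp : ∀ t, |q t - p t| ≤ δ) (hp : HasPeaksIn p V)
    (hp' : HasPeaksIn (-p) V) (hl : 0 < l) (hT : ∀ i < l, T i < T (i + 1))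
    (hS : ∀ i < l, Shortcut δ q p (T i) (T (i + 1)))
    (hmin : ∀ i j, i + 1 < j → j ≤ l → ¬ Shortcut δ q p (T i) (T j))
    (h0 : T 0 ∈ V) (hlV : T l ∈ V) :
    ∃ θ : ℕ → τ, (∀ i ≤ l, θ i ∈ V ∧ |q (T i) - p (θ i)| ≤ 5 * δ) ∧
      ∀ i j, i ≤ j → j ≤ l → θ i ≤ θ j := by
  have hδ : 0 ≤ δ := (abs_nonneg _).trans (hqp (T 0))
  have hTm : ∀ i j, i ≤ j → j ≤ l → T i ≤ T j := by
    intro i j hij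
    induction j, hij using Nat.le_induction with
    | base => intro _; exact le_rfl
    | succ j hij ih => intro hj; exact (ih (by omega)).trans (hT j hj).le
  have hex : ∀ j, ∃ θ : τ, j ≤ l → IsAnchor (fun i => q (T i)) l (4 * δ) j →
      θ ∈ V ∧ |p θ - q (T j)| ≤ δ ∧ (j = 0 → θ = T 0) ∧ (j = l → θ = T l) ∧
      (0 < j → T (j - 1) ≤ θ) ∧ (j < l → θ ≤ T (j + 1)) := by
    intro j
    by_cases hj0 : j = 0
    · subst hj0
      exact ⟨T 0, fun _ _ => ⟨h0, by rw [abs_sub_comm]; exact hqp _, fun _ => rfl,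
        fun h => by rw [← h], fun h => absurd h (lt_irrefl _), fun h => (hT 0 h).le⟩⟩
    by_cases hjl : j = l
    · subst hjl
      exact ⟨T j, fun _ _ => ⟨hlV, by rw [abs_sub_comm]; exact hqp _, fun h => by rw [h],
        fun _ => rfl, fun h => hTm _ _ (by omega) le_rfl, fun h => absurd h (lt_irrefl _)⟩⟩
    by_cases h : j ≤ l ∧ IsAnchor (fun i => q (T i)) l (4 * δ) j
    · obtain ⟨θ, hV, h1, h2, h3⟩ := exists_mem_of_isAnchor hqp hp hp' hT hS hmin
        (by omega) (by omega) h.2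
      exact ⟨θ, fun _ _ => ⟨hV, h3, fun h => absurd h hj0, fun h => absurd h hjl, fun _ => h1.le,
        fun _ => h2.le⟩⟩
    · exact ⟨T 0, fun h1 h2 => absurd ⟨h1, h2⟩ h⟩
  choose θ hθ using hex
  obtain ⟨A, hA, hAm⟩ := (alternates_of_minimal hqp hT hS hmin).exists_anchor
    (K := 4 * δ) (by linarith)
  refine ⟨fun i => θ (A i), fun i hi => ?_, fun i j hij hj => ?_⟩
  · obtain ⟨a1, a2, a3⟩ := hA i hi
    obtain ⟨b1, b2, -⟩ := hθ _ a1 a2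
    refine ⟨b1, ?_⟩
    have := abs_le.1 a3
    have := abs_le.1 b2
    rw [abs_le]
    constructor <;> linarith
  · obtain ⟨a1, a2, -⟩ := hA i (hij.trans hj)
    obtain ⟨b1, b2, -⟩ := hA j hj
    have hm := hAm i j hij hj
    change θ (A i) ≤ θ (A j)
    generalize A i = i' at *
    generalize A j = j' at *
    obtain ⟨-, c2, c3, c4, c5, c6⟩ := hθ _ a1 a2
    obtain ⟨-, d2, d3, d4, d5, d6⟩ := hθ _ b1 b2
    rcases hm.eq_or_lt with rfl | hm
    · exact le_rfl
    rcases (Nat.succ_le_of_lt hm).eq_or_lt with rfl | hm'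
    · rcases a2.long_of_succ b2 b1 with h | h | h
      · rw [c3 h]
        exact (hTm _ _ (by omega) (by omega)).trans (d5 (by omega))
      · rw [d4 h]
        exact (c6 (by omega)).trans (hTm _ _ (by omega) le_rfl)
      -- In the wrong order both points lie over the single long edge. Their values are within `δ`
      -- of its ends, so `p` would move against the edge by more than `4δ - 2δ`, which a shortcut
      -- forbids. This is the origin of the threshold `4δ`.
      · by_contra hlt
        rw [not_le] at hlt
        have e1 : T i' ≤ θ (i' + 1) := d5 (by omega)
        have e2 : θ i' ≤ T (i' + 1) := c6 (by omega)
        have f1 := abs_le.1 c2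
        have f2 := abs_le.1 d2
        simp only [Nat.succ_eq_add_one] at f2 h
        have hle := (hT i' (by omega)).le
        rcases hS i' (by omega) with g | g
        · have g1 := g.drop_right _ ⟨e1, hlt.le.trans e2⟩ _ ⟨e1.trans hlt.le, e2⟩ hlt.le
          have g2 := (g.mem _ ⟨le_rfl, hle⟩).2
          rw [abs_of_nonneg (by linarith)] at h
          linarith
        · have g1 := g.drop_right _ ⟨e1, hlt.le.trans e2⟩ _ ⟨e1.trans hlt.le, e2⟩ hlt.le
          have g2 := (g.mem _ ⟨le_rfl, hle⟩).2
          simp only [Pi.neg_apply] at g1 g2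
          rw [abs_of_nonpos (by linarith)] at h
          linarith
    -- Anchors at least two apart are separated by the vertex after the first.
    · exact (c6 (by omega)).trans ((hTm _ _ (by omega) (by omega)).trans (d5 (by omega)))

end Visiting

/-! ### Tracking along shortcuts. -/

section Tracking

variable {δ : ℝ} {x y : I}

theorem Ascends.of_monotoneOn {τ : Type*} [LinearOrder τ] {q p : τ → ℝ} {x y : τ}
    (hqp : ∀ t, |q t - p t| ≤ δ) (hxy : x ≤ y) (h : MonotoneOn q (Set.Icc x y)) :
    Ascends δ q p x y := by
  have hδ : 0 ≤ δ := (abs_nonneg _).trans (hqp x)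
  refine ⟨fun s hs => ⟨h ⟨le_rfl, hxy⟩ hs hs.1, h hs ⟨hxy, le_rfl⟩ hs.2⟩,
    fun s hs s' hs' hss => ?_, fun s hs s' hs' hss => ?_⟩
  · linarith [h hs hs' hss]
  · have := h hs hs' hss
    have := abs_le.1 (hqp s)
    have := abs_le.1 (hqp s')
    linarith

theorem Ascends.comp {τ ρ : Type*} [LinearOrder τ] [LinearOrder ρ] {q p : τ → ℝ} {r : ρ → τ}
    (hr : Monotone r) {x y : ρ} (h : Ascends δ q p (r x) (r y)) :
    Ascends δ (q ∘ r) (p ∘ r) x y :=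
  have hm : ∀ s ∈ Set.Icc x y, r s ∈ Set.Icc (r x) (r y) := fun _ hs => ⟨hr hs.1, hr hs.2⟩
  ⟨fun s hs => h.mem _ (hm s hs), fun s hs s' hs' hss => h.drop_left _ (hm s hs) _ (hm s' hs') (hr hss),
    fun s hs s' hs' hss => h.drop_right _ (hm s hs) _ (hm s' hs') (hr hss)⟩

theorem Shortcut.comp {τ ρ : Type*} [LinearOrder τ] [LinearOrder ρ] {q p : τ → ℝ} {r : ρ → τ}
    (hr : Monotone r) {x y : ρ} (h : Shortcut δ q p (r x) (r y)) :
    Shortcut δ (q ∘ r) (p ∘ r) x y :=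
  h.imp (fun h => h.comp hr) (fun h => h.comp hr)

theorem Shortcut.self {τ : Type*} [LinearOrder τ] {q p : τ → ℝ} {x y : τ}
    (h : Shortcut δ q p x y) : Shortcut δ q q x y :=
  h.imp (fun h => ⟨h.mem, h.drop_left, h.drop_left⟩) (fun h => ⟨h.mem, h.drop_left, h.drop_left⟩)

theorem Shortcut.mem_segment {τ : Type*} [LinearOrder τ] {q p : τ → ℝ} {x y : τ}
    (h : Shortcut δ q p x y) {s : τ} (hs : s ∈ Set.Icc x y) : q s ∈ segment ℝ (q x) (q y) := by
  rw [segment_eq_uIcc, Set.mem_uIcc]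
  rcases h with h | h
  · exact .inl (h.mem s hs)
  · have := h.mem s hs
    simp only [Pi.neg_apply, neg_le_neg_iff] at this
    exact .inr this.symm

theorem Ascends.trackable {q p : I → ℝ} (hqp : ∀ t, |q t - p t| ≤ δ) {κ : ℝ → I} (hκ : Monotone κ)
    (h0 : κ 0 = x) (h1 : κ 1 = y) (h : Ascends δ q p x y) :
    Trackable δ (p ∘ κ) (q x) (q y) := by
  have hm : ∀ s ∈ Set.Icc (0 : ℝ) 1, κ s ∈ Set.Icc x y := fun s hs =>
    ⟨h0 ▸ hκ hs.1, h1 ▸ hκ hs.2⟩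
  refine ⟨?_, ?_, fun s hs => ?_, fun s hs s' hs' hss =>
    h.drop_right _ (hm s hs) _ (hm s' hs') (hκ hss)⟩
  · rw [abs_sub_comm, Function.comp, h0]; exact hqp x
  · rw [abs_sub_comm, Function.comp, h1]; exact hqp y
  · have e1 := h.mem _ (hm s hs)
    have e2 := abs_le.1 (hqp (κ s))
    simp only [Function.comp]
    constructor <;> linarith

/-- The affine parametrization of `[x, y]`. -/
def affineParam (x y s : I) : I :=
  ⟨(1 - (s : ℝ)) * x + s * y,
    (convex_Icc (0 : ℝ) 1) x.2 y.2 (sub_nonneg.2 s.2.2) s.2.1 (sub_add_cancel _ _)⟩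

theorem affineParam_monotone (hxy : x ≤ y) : Monotone (affineParam x y) := by
  intro s s' hss
  have h1 : (x : ℝ) ≤ y := hxy
  have h2 : (s : ℝ) ≤ s' := hss
  have h3 := mul_nonneg (sub_nonneg.2 h1) (sub_nonneg.2 h2)
  change (1 - (s : ℝ)) * x + s * y ≤ (1 - (s' : ℝ)) * x + s' * y
  linarith

theorem continuous_affineParam (x y : I) : Continuous (affineParam x y) := by
  unfold affineParam
  fun_prop

theorem Shortcut.exists_fraction {q p : I → ℝ} (hp : Continuous p) (hqp : ∀ t, |q t - p t| ≤ δ)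
    (hxy : x ≤ y) (h : Shortcut δ q p x y) :
    ∃ Φ : ℝ → ℝ, Continuous Φ ∧ Monotone Φ ∧ (∀ s ≤ 0, Φ s = 0) ∧ (∀ s, 1 ≤ s → Φ s = 1) ∧
      ∀ s : I, |q x + Φ s * (q y - q x) - p (affineParam x y s)| ≤ δ := by
  let κ : ℝ → I := fun s => affineParam x y (Set.projIcc 0 1 zero_le_one s)
  have hκ : Monotone κ := (affineParam_monotone hxy).comp (Set.monotone_projIcc _)
  have hκc : Continuous κ := (continuous_affineParam x y).comp continuous_projIcc
  have h0 : κ 0 = x := by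
    simp only [κ, Set.projIcc_left]
    exact Subtype.ext (by simp [affineParam])
  have h1 : κ 1 = y := by
    simp only [κ, Set.projIcc_right]
    exact Subtype.ext (by simp [affineParam])
  have hx : x ∈ Set.Icc x y := ⟨le_rfl, hxy⟩
  obtain ⟨Φ, f1, f2, f3, f4, f5⟩ := exists_clamped_fraction (δ := δ) (a := q x) (b := q y)
    (hp.comp hκc) (h.imp (fun h => ⟨(h.mem x hx).2, h.trackable hqp hκ h0 h1⟩)
      (fun h => ⟨by simpa using (h.mem x hx).2,
        h.trackable (abs_neg_sub_neg_le hqp) hκ h0 h1⟩))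
  refine ⟨Φ, f1, f2, f3, f4, fun s => ?_⟩
  simpa [κ] using f5 s s.2

theorem Shortcut.exists_fraction_on {q p : I → ℝ} (hp : Continuous p)
    (hqp : ∀ t, |q t - p t| ≤ δ) (hxy : x < y) (h : Shortcut δ q p x y) :
    ∃ Φ : ℝ → ℝ, Continuous Φ ∧ Monotone Φ ∧ (∀ s ≤ (x : ℝ), Φ s = 0) ∧
      (∀ s, (y : ℝ) ≤ s → Φ s = 1) ∧
      ∀ s ∈ Set.Icc x y, |q x + Φ s * (q y - q x) - p s| ≤ δ := by
  obtain ⟨Φ, f1, f2, f3, f4, f5⟩ := h.exists_fraction hp hqp hxy.le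
  have hpos : (0 : ℝ) < y - x := sub_pos.2 hxy
  refine ⟨fun s => Φ ((s - x) / (y - x)), by fun_prop, fun s s' hss => f2 (by gcongr),
    fun s hs => f3 _ (div_nonpos_of_nonpos_of_nonneg (by linarith) hpos.le),
    fun s hs => f4 _ ((one_le_div hpos).2 (by linarith)), fun s hs => ?_⟩
  have e1 : (x : ℝ) ≤ s := hs.1
  have e2 : (s : ℝ) ≤ y := hs.2
  have := f5 ⟨((s : ℝ) - x) / (y - x), div_nonneg (by linarith) hpos.le,
    div_le_one_of_le₀ (by linarith) hpos.le⟩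
  convert this using 4
  refine Subtype.ext ?_
  simp only [affineParam]
  field_simp
  ring

/-- Locality concerns `F` alone, so `F` tracks itself and `p` is discarded; in particular `p` need
not be continuous. -/
theorem frechetDist_segmentCurve_subcurve_le {F : C(I, ℝ)} {p : I → ℝ} (hδ : 0 ≤ δ) (hxy : x ≤ y)
    (h : Shortcut δ F p x y) :
    frechetDist (segmentCurve (F x) (F y)) (subcurve F x y) ≤ δ := by
  obtain ⟨Φ, f1, f2, f3, f4, f5⟩ := h.self.exists_fraction F.continuous (by simpa) hxy
  obtain ⟨φ, hφ⟩ := exists_reparam f1 f2 (f3 0 le_rfl) (f4 1 le_rfl)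
  refine frechetDist_le φ ⟨id, monotone_id, Function.surjective_id⟩ fun t => ?_
  convert f5 t using 2
  change (1 - (φ.1 t : ℝ)) * F x + φ.1 t * F y - F (affineParam x y t) = _
  rw [hφ]
  ring

end Tracking

/-! ### Reparametrized curves and the geometry of polygonal curves. -/

theorem HasPeaksIn.comp_reparam {F : I → ℝ} {V : Set I} (h : HasPeaksIn F V) (g : Reparam) :
    HasPeaksIn (F ∘ g.1) (g.1 ⁻¹' V) := by
  intro x y z hxy hyz h1 h2
  obtain ⟨s, hs, hxs, hsz, hmax⟩ := h _ _ _ (g.2.1 hxy) (g.2.1 hyz) h1 h2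
  obtain ⟨θ, rfl⟩ := g.2.2 s
  exact ⟨θ, hs, g.2.1.reflect_lt hxs, g.2.1.reflect_lt hsz,
    fun s hs => hmax _ ⟨g.2.1 hs.1, g.2.1 hs.2⟩⟩

/-- A section of a monotone surjection is strictly increasing, though perhaps discontinuous. Fixing
it at the ends makes the lifted vertex parameters start at `0` and end at `1`. -/
theorem Reparam.exists_rightInverse (f : Reparam) :
    ∃ r : I → I, (∀ s, f.1 (r s) = s) ∧ r 0 = 0 ∧ r 1 = 1 ∧ StrictMono r := by
  classical
  let r : I → I := fun s => if s = 0 then 0 else if s = 1 then 1 else Function.surjInv f.2.2 s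
  have hr : ∀ s, f.1 (r s) = s := by
    intro s
    simp only [r]
    split_ifs with h h'
    · rw [h, f.map_zero]
    · rw [h', f.map_one]
    · exact Function.surjInv_eq _ _
  refine ⟨r, hr, by simp [r], by simp [r], fun s s' hss => ?_⟩
  exact f.2.1.reflect_lt (by rwa [hr, hr])

theorem exists_nat_extension {α : Type*} {n : ℕ} (w : Fin (n + 1) → α) :
    ∃ u : ℕ → α, ∀ i : Fin (n + 1), w i = u i :=
  ⟨fun i => w (Fin.ofNat (n + 1) i), fun i => by simp⟩

theorem add_sum_range_mul_eq {u c : ℕ → ℝ} {n k : ℕ} (hk : k < n) (h1 : ∀ i < k, c i = 1)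
    (h0 : ∀ i, k < i → c i = 0) :
    u 0 + ∑ i ∈ Finset.range n, (u (i + 1) - u i) * c i = u k + (u (k + 1) - u k) * c k := by
  rw [← Finset.sum_subset (Finset.range_subset_range.2 (Nat.succ_le_of_lt hk)),
    Finset.sum_range_succ, Finset.sum_congr rfl (g := fun i => u (i + 1) - u i),
    Finset.sum_range_sub]
  · ring
  · intro i hi
    rw [h1 i (Finset.mem_range.1 hi), mul_one]
  · intro i _ hi
    rw [h0 i (by simpa using hi), mul_zero]

namespace PolygonalCurve

theorem curve_eq_on_edge (P : PolygonalCurve) {u : ℕ → ℝ} (hu : ∀ i, P.vertex i = u i) {k : ℕ}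
    (hk : k < P.numEdges) {t : I} (h1 : (k : ℝ) ≤ P.numEdges * t)
    (h2 : (P.numEdges : ℝ) * t ≤ k + 1) :
    P.curve t = u k + (u (k + 1) - u k) * (P.numEdges * t - k) := by
  have h3 : P.curve t = u 0 + ∑ i ∈ Finset.range P.numEdges,
      (u (i + 1) - u i) * max 0 (min 1 ((P.numEdges : ℝ) * t - i)) := by
    rw [← Fin.sum_univ_eq_sum_range
      (fun i => (u (i + 1) - u i) * max 0 (min 1 ((P.numEdges : ℝ) * t - i)))]
    simp [curve, hu]
  rw [h3, add_sum_range_mul_eq hk]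
  · rw [min_eq_right (by linarith), max_eq_right (by linarith)]
  · intro i hi
    have : (i : ℝ) + 1 ≤ k := by exact_mod_cast hi
    rw [min_eq_left (by linarith), max_eq_right zero_le_one]
  · intro i hi
    have : (k : ℝ) + 1 ≤ i := by exact_mod_cast hi
    rw [min_eq_right (by linarith), max_eq_left (by linarith)]

theorem exists_edge {n : ℕ} (hn : 0 < n) (t : I) :
    ∃ k < n, (k : ℝ) ≤ n * t ∧ (n : ℝ) * t ≤ k + 1 := by
  have h0 : (0 : ℝ) ≤ n * t := mul_nonneg (Nat.cast_nonneg _) t.2.1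
  have h1 : (n : ℝ) * t ≤ n := mul_le_of_le_one_right (Nat.cast_nonneg _) t.2.2
  by_cases h : ⌊(n : ℝ) * t⌋₊ < n
  · exact ⟨_, h, Nat.floor_le h0, (Nat.lt_floor_add_one _).le⟩
  · have h2 : (n : ℝ) ≤ n * t := (Nat.le_floor_iff h0).1 (not_lt.1 h)
    refine ⟨n - 1, by omega, ?_, ?_⟩ <;> push_cast [Nat.cast_sub (Nat.succ_le_of_lt hn)] <;>
      linarith

theorem curve_of_numEdges_eq_zero (P : PolygonalCurve) (h : P.numEdges = 0) (t : I)
    (k : Fin (P.numEdges + 1)) : P.curve t = P.vertex k := by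
  obtain ⟨n, v⟩ := P
  simp only at h
  subst h
  rw [show k = 0 from Subsingleton.elim (α := Fin 1) k 0]
  simp [curve]

theorem curve_eq_vertex (P : PolygonalCurve) {t : I} {k : Fin (P.numEdges + 1)}
    (h : (P.numEdges : ℝ) * t = (k : ℕ)) : P.curve t = P.vertex k := by
  rcases Nat.eq_zero_or_pos P.numEdges with h0 | h0
  · exact P.curve_of_numEdges_eq_zero h0 t k
  obtain ⟨u, hu⟩ := exists_nat_extension P.vertex
  obtain ⟨j, hj, h1, h2⟩ := exists_edge h0 t
  rw [P.curve_eq_on_edge hu hj h1 h2, hu k]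
  rw [h] at h1 h2 ⊢
  have h1' : j ≤ (k : ℕ) := by exact_mod_cast h1
  have h2' : (k : ℕ) ≤ j + 1 := by exact_mod_cast h2
  rcases h1'.eq_or_lt with e | e
  · rw [← e]; ring
  · rw [show (k : ℕ) = j + 1 by omega]; push_cast; ring

theorem numEdges_mul_param (P : PolygonalCurve) (k : Fin (P.numEdges + 1)) :
    (P.numEdges : ℝ) * P.param k = (k : ℕ) := by
  rcases Nat.eq_zero_or_pos P.numEdges with h | h
  · have := k.2
    rw [show (k : ℕ) = 0 by omega]
    simp [h]
  · simp only [param]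
    field_simp

theorem curve_param (P : PolygonalCurve) (k : Fin (P.numEdges + 1)) :
    P.curve (P.param k) = P.vertex k :=
  P.curve_eq_vertex (P.numEdges_mul_param k)

theorem param_strictMono (P : PolygonalCurve) : StrictMono P.param := by
  intro i j hij
  have h : 0 < P.numEdges := by have := i.2; have := j.2; have : (i : ℕ) < j := hij; omega
  have h' : (0 : ℝ) < P.numEdges := by exact_mod_cast h
  refine Subtype.coe_lt_coe.1 ((mul_lt_mul_iff_right₀ h').1 ?_)
  rw [P.numEdges_mul_param, P.numEdges_mul_param]
  exact_mod_cast hij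

theorem param_zero (P : PolygonalCurve) : P.param 0 = 0 :=
  Subtype.ext (by simp [param])

theorem param_last (P : PolygonalCurve) (h : 0 < P.numEdges) : P.param (Fin.last _) = 1 := by
  refine Subtype.ext ?_
  simp only [param, Fin.val_last, Set.Icc.coe_one]
  have h' : (P.numEdges : ℝ) ≠ 0 := by exact_mod_cast h.ne'
  exact div_self h'

/-- The parameters of the vertices of a curve with `n` edges. -/
def vertexParams (n : ℕ) : Set I := {t | ∃ k : Fin (n + 1), (n : ℝ) * t = (k : ℕ)}

/-- On the edge through a maximizer the curve is affine, so moving uphill keeps the maximum. The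
move reaches a vertex before leaving `[x, z]`, because the values at `x` and `z` are strictly
smaller. -/
theorem hasPeaksIn_curve (P : PolygonalCurve) : HasPeaksIn P.curve (vertexParams P.numEdges) := by
  intro x y z hxy hyz hx hz
  rcases Nat.eq_zero_or_pos P.numEdges with h0 | h0
  · rw [P.curve_of_numEdges_eq_zero h0 x 0, P.curve_of_numEdges_eq_zero h0 y 0] at hx
    exact absurd hx (lt_irrefl _)
  obtain ⟨s, hs, hmax⟩ := isCompact_Icc.exists_isMaxOn ⟨y, hxy, hyz⟩
    (P.curve.continuous.continuousOn (s := Set.Icc x z))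
  have hmax' : ∀ t ∈ Set.Icc x z, P.curve t ≤ P.curve s := fun t ht => hmax ht
  have hys := hmax' y ⟨hxy, hyz⟩
  obtain ⟨u, hu⟩ := exists_nat_extension P.vertex
  obtain ⟨k, hk, h1, h2⟩ := exists_edge h0 s
  have hn : (0 : ℝ) < P.numEdges := by exact_mod_cast h0
  let a : I := P.param ⟨k, by omega⟩
  let b : I := P.param ⟨k + 1, by omega⟩
  have ha : (P.numEdges : ℝ) * a = k := P.numEdges_mul_param _
  have hb : (P.numEdges : ℝ) * b = k + 1 := by
    simpa using P.numEdges_mul_param ⟨k + 1, by omega⟩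
  have has : a ≤ s := Subtype.coe_le_coe.1 ((mul_le_mul_iff_right₀ hn).1 (by linarith))
  have hsb : s ≤ b := Subtype.coe_le_coe.1 ((mul_le_mul_iff_right₀ hn).1 (by linarith))
  have hedge : ∀ t : I, a ≤ t → t ≤ b →
      P.curve t = u k + (u (k + 1) - u k) * (P.numEdges * t - k) := by
    intro t hat htb
    have e1 := mul_le_mul_of_nonneg_left (Subtype.coe_le_coe.2 hat) hn.le
    have e2 := mul_le_mul_of_nonneg_left (Subtype.coe_le_coe.2 htb) hn.le
    exact P.curve_eq_on_edge hu hk (by linarith) (by linarith)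
  have hls : max a x ≤ s := max_le has hs.1
  have hsr : s ≤ min b z := le_min hsb hs.2
  have el := hedge (max a x) (le_max_left _ _) (hls.trans hsb)
  have er := hedge (min b z) (has.trans hsr) (min_le_left _ _)
  have es := hedge s has hsb
  have hls' := mul_le_mul_of_nonneg_left (Subtype.coe_le_coe.2 hls) hn.le
  have hsr' := mul_le_mul_of_nonneg_left (Subtype.coe_le_coe.2 hsr) hn.le
  rcases le_total (u (k + 1) - u k) 0 with hd | hd
  · have hle : P.curve s ≤ P.curve (max a x) := by
      rw [el, es]
      have := mul_le_mul_of_nonpos_left hls' hd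
      linarith
    have hxa : x < a := by
      by_contra h
      rw [max_eq_right (not_lt.1 h)] at hle
      linarith
    rw [max_eq_left hxa.le] at hle
    refine ⟨a, ⟨_, P.numEdges_mul_param _⟩, hxa, lt_of_le_of_ne (has.trans hs.2) fun h => ?_,
      fun t ht => (hmax' t ht).trans hle⟩
    rw [h] at hle
    linarith
  · have hle : P.curve s ≤ P.curve (min b z) := by
      rw [er, es]
      have := mul_le_mul_of_nonneg_left hsr' hd
      linarith
    have hbz : b < z := by
      by_contra h
      rw [min_eq_right (not_lt.1 h)] at hle
      linarith
    rw [min_eq_left hbz.le] at hle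
    refine ⟨b, ⟨_, P.numEdges_mul_param _⟩, lt_of_le_of_ne (hs.1.trans hsb) fun h => ?_, hbz,
      fun t ht => (hmax' t ht).trans hle⟩
    rw [← h] at hle
    linarith

theorem hasPeaksIn_neg_curve (P : PolygonalCurve) :
    HasPeaksIn (-P.curve) (vertexParams P.numEdges) := by
  have h := hasPeaksIn_curve ⟨P.numEdges, -P.vertex⟩
  have e : (⇑(curve ⟨P.numEdges, -P.vertex⟩) : I → ℝ) = -P.curve := by
    funext t
    simp only [curve, ContinuousMap.coe_mk, Pi.neg_apply, neg_add, ← Finset.sum_neg_distrib]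
    congr 1
    exact Finset.sum_congr rfl fun i _ => by ring
  rw [e] at h
  exact h

end PolygonalCurve

/-! ### The straightening for a fixed matching. -/

namespace PolygonalCurve

theorem shortcut_edge (Q : PolygonalCurve) {δ : ℝ} {f : Reparam} {p : I → ℝ}
    (hqp : ∀ t, |(Q.curve ∘ f.1) t - p t| ≤ δ) {k : ℕ} (hk : k < Q.numEdges) {x y : I} (hxy : x ≤ y)
    (hx : (Q.numEdges : ℝ) * f.1 x = k) (hy : (Q.numEdges : ℝ) * f.1 y = k + 1) :
    Shortcut δ (Q.curve ∘ f.1) p x y := by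
  obtain ⟨u, hu⟩ := exists_nat_extension Q.vertex
  have hf : ∀ s ∈ Set.Icc x y, ∀ s' ∈ Set.Icc x y, s ≤ s' →
      (Q.numEdges : ℝ) * f.1 s ≤ Q.numEdges * f.1 s' := fun s _ s' _ hss =>
    mul_le_mul_of_nonneg_left (Subtype.coe_le_coe.2 (f.2.1 hss)) (Nat.cast_nonneg _)
  have hedge : ∀ s ∈ Set.Icc x y, (Q.curve ∘ f.1) s =
      u k + (u (k + 1) - u k) * (Q.numEdges * f.1 s - k) := fun s hs =>
    Q.curve_eq_on_edge hu hk (hx ▸ hf x ⟨le_rfl, hxy⟩ s hs hs.1)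
      (hy ▸ hf s hs y ⟨hxy, le_rfl⟩ hs.2)
  rcases le_total 0 (u (k + 1) - u k) with hd | hd
  · refine .inl (.of_monotoneOn hqp hxy fun s hs s' hs' hss => ?_)
    rw [hedge s hs, hedge s' hs']
    have := mul_le_mul_of_nonneg_left (hf s hs s' hs' hss) hd
    linarith
  · refine .inr (.of_monotoneOn (abs_neg_sub_neg_le hqp) hxy fun s hs s' hs' hss => ?_)
    rw [Pi.neg_apply, Pi.neg_apply, hedge s hs, hedge s' hs']
    have := mul_le_mul_of_nonpos_left (hf s hs s' hs' hss) hd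
    linarith

theorem nondegenerate_of_alternates {P : PolygonalCurve} {v : ℕ → ℝ} (hv : ∀ i, P.vertex i = v i)
    (h : Alternates v P.numEdges) : P.Nondegenerate := by
  intro i j k hij hjk
  have hk := k.2
  rw [hv, hv, hv, ← hjk, ← hij, segment_eq_uIcc, Set.mem_uIcc]
  rcases h i (by omega) with ⟨h1, h2⟩ | ⟨h1, h2⟩ <;> rintro (⟨h3, h4⟩ | ⟨h3, h4⟩) <;> linarith

theorem exists_mem_Icc_of_chain {T : ℕ → I} {l : ℕ} (h0 : T 0 = 0) (h1 : T l = 1) (hl : 0 < l)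
    (t : I) : ∃ k < l, t ∈ Set.Icc (T k) (T (k + 1)) := by
  classical
  have hex : ∃ k, t ≤ T (k + 1) := ⟨l - 1, by rw [Nat.sub_add_cancel hl, h1]; exact t.2.2⟩
  refine ⟨Nat.find hex, ?_, ?_, Nat.find_spec hex⟩
  · have : Nat.find hex ≤ l - 1 :=
      Nat.find_le (by rw [Nat.sub_add_cancel hl, h1]; exact t.2.2)
    omega
  · rcases Nat.eq_zero_or_pos (Nat.find hex) with h | h
    · rw [h, h0]; exact t.2.1
    · have := Nat.find_min hex (m := Nat.find hex - 1) (by omega)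
      rw [Nat.sub_add_cancel h] at this
      exact (not_le.1 this).le

/-- If each edge of `P'` is a shortcut for `q`, then `P'` stays within `δ` of any curve that is
within `δ` of `q`. -/
theorem frechetDist_le_of_shortcuts {P' : PolygonalCurve} {F : C(I, ℝ)} {g : Reparam} {δ : ℝ}
    {q : I → ℝ} (hqp : ∀ t, |q t - (F ∘ g.1) t| ≤ δ) {T : ℕ → I} (hl : 0 < P'.numEdges)
    (h0 : T 0 = 0) (h1 : T P'.numEdges = 1) (hT : ∀ i < P'.numEdges, T i < T (i + 1))
    (hv : ∀ i, P'.vertex i = q (T i))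
    (hS : ∀ i < P'.numEdges, Shortcut δ q (F ∘ g.1) (T i) (T (i + 1))) :
    frechetDist P'.curve F ≤ δ := by
  set l := P'.numEdges with hl'
  have hex : ∀ i, ∃ Φ : ℝ → ℝ, i < l → Continuous Φ ∧ Monotone Φ ∧
      (∀ s ≤ (T i : ℝ), Φ s = 0) ∧ (∀ s, (T (i + 1) : ℝ) ≤ s → Φ s = 1) ∧
      ∀ s ∈ Set.Icc (T i) (T (i + 1)),
        |q (T i) + Φ s * (q (T (i + 1)) - q (T i)) - (F ∘ g.1) s| ≤ δ := by
    intro i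
    by_cases hi : i < l
    · obtain ⟨Φ, h⟩ := (hS i hi).exists_fraction_on (F.continuous.comp g.continuous) hqp (hT i hi)
      exact ⟨Φ, fun _ => h⟩
    · exact ⟨0, fun h => absurd h hi⟩
  choose Φ hΦ using hex
  have hTm : ∀ i j, i ≤ j → j ≤ l → T i ≤ T j := by
    intro i j hij
    induction j, hij using Nat.le_induction with
    | base => intro _; exact le_rfl
    | succ j hij ih => intro hj; exact (ih (by omega)).trans (hT j hj).le
  have hlpos : (0 : ℝ) < l := by exact_mod_cast hl
  have hsum : ∀ k < l, ∀ t ∈ Set.Icc (T k) (T (k + 1)),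
      ∑ i ∈ Finset.range l, Φ i t = k + Φ k t := by
    intro k hk t ht
    rw [← Finset.sum_subset (Finset.range_subset_range.2 (Nat.succ_le_of_lt hk)),
      Finset.sum_range_succ, Finset.sum_congr rfl (g := fun i => (1 : ℝ))]
    · simp
    · intro i hi
      have hi := Finset.mem_range.1 hi
      exact (hΦ i (by omega)).2.2.2.1 _
        (Subtype.coe_le_coe.2 ((hTm (i + 1) k (by omega) hk.le).trans ht.1))
    · intro i hi hi'
      have hi := Finset.mem_range.1 hi
      simp only [Nat.succ_eq_add_one, Finset.mem_range, not_lt] at hi'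
      exact (hΦ i hi).2.2.1 _
        (Subtype.coe_le_coe.2 (ht.2.trans (hTm (k + 1) i hi' hi.le)))
  -- On the `k`-th interval the earlier fractions are `1` and the later ones `0`, so the sum is `k +
  -- Φ k`: edge `k` of `P'` at fraction `Φ k`.
  obtain ⟨φ, hφ⟩ := exists_reparam (Φ := fun t => (∑ i ∈ Finset.range l, Φ i t) / l)
    (by
      refine Continuous.div_const (continuous_finsetSum _ fun i hi => ?_) _
      exact (hΦ i (Finset.mem_range.1 hi)).1)
    (fun s s' hss => div_le_div_of_nonneg_right
      (Finset.sum_le_sum fun i hi => (hΦ i (Finset.mem_range.1 hi)).2.1 hss) hlpos.le)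
    (by
      rw [Finset.sum_eq_zero, zero_div]
      intro i hi
      exact (hΦ i (Finset.mem_range.1 hi)).2.2.1 _ (T i).2.1)
    (by
      rw [Finset.sum_congr rfl (g := fun i => (1 : ℝ))]
      · simp [hlpos.ne']
      · intro i hi
        exact (hΦ i (Finset.mem_range.1 hi)).2.2.2.1 _ (T (i + 1)).2.2)
  refine frechetDist_le φ g fun t => ?_
  obtain ⟨k, hk, ht⟩ := exists_mem_Icc_of_chain h0 h1 hl t
  obtain ⟨c1, c2, c3, c4, c5⟩ := hΦ k hk
  have hmul : (l : ℝ) * φ.1 t = k + Φ k t := by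
    rw [hφ, ← hsum k hk t ht]
    field_simp
  have hge : 0 ≤ Φ k t := by
    rw [← c3 _ le_rfl]
    exact c2 (Subtype.coe_le_coe.2 ht.1)
  have hle : Φ k t ≤ 1 := by
    rw [← c4 _ le_rfl]
    exact c2 (Subtype.coe_le_coe.2 ht.2)
  rw [P'.curve_eq_on_edge (u := fun i => q (T i)) hv hk (by linarith) (by linarith), hmul]
  convert c5 t ht using 2
  simp only [Function.comp]
  ring

/-- The polygonal curve through the vertices of `Q` with the indices `t 0, …, t l`. -/
def reindex (Q : PolygonalCurve) {l : ℕ} (t : Fin (l + 1) → Fin (Q.numEdges + 1)) :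
    PolygonalCurve :=
  ⟨l, Q.vertex ∘ t⟩

/-- The vertices of `Q` with the indices `t` form a `δ`-straightening that has `κ` as a visiting
order on `P` and is within Fréchet distance `δ` of `P`. -/
def IsGoodStraightening (P Q : PolygonalCurve) {l : ℕ} (t : Fin (l + 1) → Fin (Q.numEdges + 1))
    (κ : Fin (l + 1) → Fin (P.numEdges + 1)) (δ : ℝ) : Prop :=
  IsSimplification δ Q (Q.reindex t) t ∧ IsEdgeRangePreserving Q (Q.reindex t) t ∧
    IsVisitingOrder (11 * δ) (Q.reindex t) P κ ∧ frechetDist (Q.reindex t).curve P.curve ≤ δ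

theorem isGoodStraightening_point (P Q : PolygonalCurve) {δ : ℝ} {f g : Reparam}
    (h : ∀ t, |Q.curve (f.1 t) - P.curve (g.1 t)| ≤ δ) (hQ : Q.numEdges = 0) :
    IsGoodStraightening P Q (l := 0) (fun _ => 0) (fun _ => 0) δ := by
  have hδ : 0 ≤ δ := (abs_nonneg _).trans (h 0)
  refine ⟨⟨fun i j hij => absurd hij (by rw [show i = j from Subsingleton.elim (α := Fin 1) i j]; exact lt_irrefl j), rfl,
    Fin.ext (by simp [hQ]), fun _ => rfl, fun i j k hij hjk => ?_, fun i => i.elim0⟩,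
    fun i => i.elim0, ⟨monotone_const, fun j => ?_⟩, frechetDist_le f g fun t => ?_⟩
  · have : (j : ℕ) < 0 + 1 := j.2
    omega
  · have h0 := h 0
    rw [g.map_zero, Q.curve_of_numEdges_eq_zero hQ _ 0, P.curve_eq_vertex (k := 0) (by simp)] at h0
    exact h0.trans (by linarith)
  · rw [curve_of_numEdges_eq_zero (Q.reindex fun _ => 0) rfl _ 0]
    have h0 := h t
    rwa [Q.curve_of_numEdges_eq_zero hQ _ 0] at h0

theorem exists_isGoodStraightening (P Q : PolygonalCurve) {δ : ℝ} {f g : Reparam}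
    (h : ∀ t, |Q.curve (f.1 t) - P.curve (g.1 t)| ≤ δ) :
    ∃ (l : ℕ) (t : Fin (l + 1) → Fin (Q.numEdges + 1)) (κ : Fin (l + 1) → Fin (P.numEdges + 1)),
      IsGoodStraightening P Q t κ δ := by
  rcases Nat.eq_zero_or_pos Q.numEdges with hQ | hQ
  · exact ⟨0, _, _, isGoodStraightening_point P Q h hQ⟩
  have hδ : 0 ≤ δ := (abs_nonneg _).trans (h 0)
  set q : I → ℝ := Q.curve ∘ f.1 with hq
  set p : I → ℝ := P.curve ∘ g.1
  have hqp : ∀ t, |q t - p t| ≤ δ := h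
  obtain ⟨r, hfr, hr0, hr1, hr⟩ := f.exists_rightInverse
  obtain ⟨τ, hτ⟩ := exists_nat_extension fun k => r (Q.param k)
  have hτ' : ∀ k (hk : k ≤ Q.numEdges), τ k = r (Q.param ⟨k, by omega⟩) := fun k hk =>
    (hτ ⟨k, by omega⟩).symm
  have hτlt : ∀ a b, a < b → b ≤ Q.numEdges → τ a < τ b := by
    intro a b hab hb
    rw [hτ' a (by omega), hτ' b hb]
    exact hr (Q.param_strictMono hab)
  -- Only vertices of `Q` may be joined, so the chain is minimal among sequences of vertex indices.
  obtain ⟨l, t, ht0, htl, htlt, htS, htmin⟩ := exists_shortest_chain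
    (fun a b => Shortcut δ q p (τ a) (τ b)) Q.numEdges (fun k hk => by
      refine Q.shortcut_edge hqp hk (hτlt k (k + 1) (by omega) hk).le ?_ ?_
      · rw [hτ' k hk.le, hfr, Q.numEdges_mul_param]
      · rw [hτ' (k + 1) hk, hfr, Q.numEdges_mul_param]
        push_cast
        rfl)
  have htm : ∀ i j, i < j → j ≤ l → t i < t j := by
    intro i j hij
    induction j, hij using Nat.le_induction with
    | base => intro hj; exact htlt i hj
    | succ j hij ih => intro hj; exact (ih (by omega)).trans (htlt j hj)
  have htle : ∀ i ≤ l, t i ≤ Q.numEdges := by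
    intro i hi
    rcases hi.eq_or_lt with rfl | hi
    · exact htl.le
    · exact htl ▸ (htm i l hi le_rfl).le
  have hl : 0 < l := by
    rcases Nat.eq_zero_or_pos l with h | h
    · rw [h, ht0] at htl; omega
    · exact h
  let T : ℕ → I := fun i => τ (t i)
  let tF : Fin (l + 1) → Fin (Q.numEdges + 1) := fun i =>
    ⟨t i, Nat.lt_succ_of_le (htle i (Nat.le_of_lt_succ i.2))⟩
  have hTt : ∀ i : Fin (l + 1), T i = r (Q.param (tF i)) := fun i => (hτ (tF i)).symm
  have hT : ∀ i < l, T i < T (i + 1) := fun i hi => hτlt _ _ (htlt i hi) (htle _ hi)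
  have hT0 : T 0 = 0 := by
    have := hTt 0
    rw [show tF 0 = 0 from Fin.ext ht0, Q.param_zero, hr0] at this
    exact this
  have hTl : T l = 1 := by
    have := hTt (Fin.last l)
    rw [show tF (Fin.last l) = Fin.last _ from Fin.ext htl, Q.param_last hQ, hr1] at this
    exact this
  have hv : ∀ i, (Q.reindex tF).vertex i = q (T i) := by
    intro i
    rw [hTt i, hq, Function.comp, hfr, Q.curve_param]
    rfl
  have hpeak : HasPeaksIn p (g.1 ⁻¹' vertexParams P.numEdges) := P.hasPeaksIn_curve.comp_reparam g
  have hpeak' : HasPeaksIn (-p) (g.1 ⁻¹' vertexParams P.numEdges) :=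
    P.hasPeaksIn_neg_curve.comp_reparam g
  obtain ⟨θ, hθ, hθm⟩ := exists_monotone_visits hqp hpeak hpeak' hl hT htS htmin
    ⟨0, by simp [hT0, g.map_zero]⟩ ⟨Fin.last _, by simp [hTl, g.map_one]⟩
  have hκ : ∀ i : Fin (l + 1), ∃ k : Fin (P.numEdges + 1),
      (P.numEdges : ℝ) * g.1 (θ i) = (k : ℕ) := fun i => (hθ i (Nat.le_of_lt_succ i.2)).1
  choose κ hκ using hκ
  have hSQ : ∀ i : Fin l, Shortcut δ Q.curve (p ∘ r) (Q.param (tF i.castSucc))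
      (Q.param (tF i.succ)) := by
    intro i
    have := htS i i.2
    change Shortcut δ q p (T i.castSucc) (T i.succ) at this
    rw [hTt, hTt] at this
    -- Pulling back along the section `r` turns `q` into `Q` in its own parametrization.
    have := this.comp hr.monotone
    rwa [show q ∘ r = Q.curve from funext fun s => by simp [hq, hfr]] at this
  have htF : StrictMono tF := fun i j hij => htm i j hij (Nat.le_of_lt_succ j.2)
  have hle : ∀ i : Fin l, Q.param (tF i.castSucc) ≤ Q.param (tF i.succ) := fun i =>
    Q.param_strictMono.monotone (htF.monotone (Fin.castSucc_lt_succ (i := i)).le)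
  have hvp : ∀ i, (Q.reindex tF).vertex i = Q.curve (Q.param (tF i)) := fun i =>
    (Q.curve_param _).symm
  refine ⟨l, tF, κ, ⟨htF, Fin.ext ht0, Fin.ext htl, fun _ => rfl,
    nondegenerate_of_alternates (v := fun i => q (T i)) hv
      (alternates_of_minimal hqp hT htS htmin), fun i => ?_⟩, fun i s hs => ?_,
    ⟨fun i j hij => ?_, fun j => ?_⟩,
    frechetDist_le_of_shortcuts hqp (T := T) hl hT0 hTl hT hv htS⟩
  · rw [hvp, hvp]
    exact frechetDist_segmentCurve_subcurve_le hδ (hle i) (hSQ i)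
  · rw [hvp, hvp]
    exact (hSQ i).mem_segment hs
  · have h1 := mul_le_mul_of_nonneg_left
      (Subtype.coe_le_coe.2 (g.2.1 (hθm i j hij (Nat.le_of_lt_succ j.2))))
      (Nat.cast_nonneg (α := ℝ) P.numEdges)
    have h2 : ((κ i : ℕ) : ℝ) ≤ (κ j : ℕ) := (hκ i).symm.trans_le (h1.trans_eq (hκ j))
    exact_mod_cast h2
  · have h1 := (hθ j (Nat.le_of_lt_succ j.2)).2
    rw [hv, ← P.curve_eq_vertex (hκ j)]
    exact h1.trans (by linarith)

/-! ### From all `ε > δ` to `δ`. -/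

theorem IsGoodStraightening.mono {P Q : PolygonalCurve} {l : ℕ}
    {t : Fin (l + 1) → Fin (Q.numEdges + 1)} {κ : Fin (l + 1) → Fin (P.numEdges + 1)} {δ ε : ℝ}
    (h : IsGoodStraightening P Q t κ δ) (hδ : δ ≤ ε) : IsGoodStraightening P Q t κ ε := by
  obtain ⟨⟨h1, h2, h3, h4, h5, h6⟩, h7, ⟨h8, h9⟩, h10⟩ := h
  exact ⟨⟨h1, h2, h3, h4, h5, fun i => (h6 i).trans hδ⟩, h7,
    ⟨h8, fun j => (h9 j).trans (by linarith)⟩, h10.trans hδ⟩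

theorem IsGoodStraightening.of_forall_gt {P Q : PolygonalCurve} {l : ℕ}
    {t : Fin (l + 1) → Fin (Q.numEdges + 1)} {κ : Fin (l + 1) → Fin (P.numEdges + 1)} {δ : ℝ}
    (h : ∀ ε, δ < ε → IsGoodStraightening P Q t κ ε) : IsGoodStraightening P Q t κ δ := by
  obtain ⟨⟨h1, h2, h3, h4, h5, -⟩, h7, ⟨h8, -⟩, -⟩ := h (δ + 1) (by linarith)
  refine ⟨⟨h1, h2, h3, h4, h5, fun i => le_of_forall_gt_imp_ge_of_dense fun ε hε =>
    (h ε hε).1.locality i⟩, h7, ⟨h8, fun j => le_of_forall_gt_imp_ge_of_dense fun ε hε => ?_⟩,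
    le_of_forall_gt_imp_ge_of_dense fun ε hε => (h ε hε).2.2.2⟩
  have := (h (ε / 11) (by linarith)).2.2.1.2 j
  rwa [mul_div_cancel₀ _ (by norm_num : (11 : ℝ) ≠ 0)] at this

/-- Bounds the length of the candidates, so that they form a finite type. -/
theorem IsGoodStraightening.length_le {P Q : PolygonalCurve} {l : ℕ}
    {t : Fin (l + 1) → Fin (Q.numEdges + 1)} {κ : Fin (l + 1) → Fin (P.numEdges + 1)} {δ : ℝ}
    (h : IsGoodStraightening P Q t κ δ) : l < Q.numEdges + 1 := by
  have := Fintype.card_le_of_injective t h.1.strictMono.injective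
  simpa using this

end PolygonalCurve

/-- A finite family of upward closed conditions, one of which holds at every `ε > δ`, has a member
that holds at all `ε > δ`. -/
theorem exists_forall_gt_of_finite {X : Type*} [Finite X] {R : X → ℝ → Prop} {δ : ℝ}
    (hR : ∀ x ε ε', ε ≤ ε' → R x ε → R x ε') (h : ∀ ε, δ < ε → ∃ x, R x ε) :
    ∃ x, ∀ ε, δ < ε → R x ε := by
  by_contra! hcon
  choose e he hne using hcon
  obtain ⟨x₀, -⟩ := h (δ + 1) (by linarith)
  have : Nonempty X := ⟨x₀⟩
  -- If each member fails at some `e x > δ`, whichever holds at the least of these also holds at its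
  -- own `e x`.
  obtain ⟨y, hy⟩ := Finite.exists_min e
  obtain ⟨x, hx⟩ := h (e y) (he y)
  exact hne x (hR x _ _ (hy x) hx)

theorem mainTheorem12 (P Q : PolygonalCurve) (δ : ℝ)
    (h : frechetDist Q.curve P.curve ≤ δ) :
    ∃ Q' : PolygonalCurve, PolygonalCurve.IsStraightening δ Q Q' ∧
      (∃ κ : Fin (Q'.numEdges + 1) → Fin (P.numEdges + 1),
        PolygonalCurve.IsVisitingOrder (11 * δ) Q' P κ) ∧
      frechetDist Q'.curve P.curve ≤ δ := by
  let X := Σ l : Fin (Q.numEdges + 1), (Fin ((l : ℕ) + 1) → Fin (Q.numEdges + 1)) ×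
    (Fin ((l : ℕ) + 1) → Fin (P.numEdges + 1))
  obtain ⟨⟨l, t, κ⟩, hx⟩ := exists_forall_gt_of_finite (X := X) (δ := δ)
    (R := fun x ε => PolygonalCurve.IsGoodStraightening P Q x.2.1 x.2.2 ε)
    (fun x ε ε' hε hx => hx.mono hε) (fun ε hε => by
      obtain ⟨f, g, hfg⟩ := exists_reparam_of_frechetDist_lt (h.trans_lt hε)
      obtain ⟨l, t, κ, hgood⟩ := PolygonalCurve.exists_isGoodStraightening P Q hfg
      exact ⟨⟨⟨l, hgood.length_le⟩, t, κ⟩, hgood⟩)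
  obtain ⟨h1, h2, h3, h4⟩ := PolygonalCurve.IsGoodStraightening.of_forall_gt hx
  exact ⟨Q.reindex t, ⟨t, h1, h2⟩, ⟨κ, h3⟩, h4⟩
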